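/- Let $n\ge 2$, let $G\subset\mathbb R^n$ be open, and let $0<\delta<1$ and $C>0$ be given. For compact $K\subset G$ put \[ \mathrm{cap}_{\delta,1}(K,G)=\inf_u \int_G\int_G\frac{|u(x)-u(y)|}{|x-y|^{n+\delta}}\,dy\,dx , \] the infimum being taken over all continuous $u:G\to\mathbb R$ with compact support in $G$ such that $u(x)\ge 1$ for every $x\in K$; for measurable $A\subset G$ put \[ P_\delta(A,G)=\int_A\int_{G\setminus A}\frac{1}{|x-y|^{n+\delta}}\,dy\,dx . \] A subset $\Gamma\subset G$, closed in $G$, is called an $(n-1)$-dimensional $C^\infty$-manifold in $G$ if for each $x\in\Gamma$ there exist open sets $U\subset\mathbb R^{n-1}$ and $V\subset\mathbb R$, a smooth function $g:U\to V$, and a rotation $\psi$ of $\mathbb R^n$ about the point $x$ such that $x\in\psi(U\times V)$ and $\Gamma\cap\psi(U\times V)=\{\psi(y,g(y)) : y\in U\}$. Let $|A|$ denote Lebesgue measure. Then the following conditions (with the same constant $C$) are equivalent. (A) For all (Lebesgue) measurable functions $u:G\to\mathbb R$ with compact support in $G$, \[ \Big(\int_G |u(x)|^{n/(n-\delta)}\,dx\Big)^{(n-\delta)/n}\le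 C\int_G\int_G\frac{|u(x)-u(y)|}{|x-y|^{n+\delta}}\,dy\,dx . \] (B) For every compact set $K\subset G$, $\;|K|^{(n-\delta)/n}\le C\,\mathrm{cap}_{\delta,1}(K,G)$. (C) For every open set $D$ whose closure is a compact subset of $G$ and whose boundary $\partial D$ is an $(n-1)$-dimensional $C^\infty$-manifold in $G$, $\;|D|^{(n-\delta)/n}\le 2C\,P_\delta(D,G)$. All integrals take values in $[0,\infty]$. -/

import Mathlib

open MeasureTheory Set
open scoped ENNReal ContDiff

/-- The fractional seminorm with exponent one,
`∫_G ∫_G |u(x) - u(y)| / |x - y| ^ (n + δ) dy dx`, as an extended nonnegative number.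
On the diagonal (a null set for `n ≥ 1`) the integrand is `0 / 0 = 0`. -/
noncomputable def fracSeminorm {n : ℕ} (δ : ℝ) (G : Set (EuclideanSpace ℝ (Fin n)))
    (u : EuclideanSpace ℝ (Fin n) → ℝ) : ℝ≥0∞ :=
  ∫⁻ x in G, ∫⁻ y in G, ‖u x - u y‖ₑ / edist x y ^ ((n : ℝ) + δ)

/-- The fractional `(δ, 1)`-capacity of `K` in `G`: the infimum of the seminorms of the continuous
functions with compact support in `G` that are at least one on `K`.
A function on `G` with compact support in `G` is represented by its extension by zero. -/
noncomputable def fracCapacity {n : ℕ} (δ : ℝ) (K G : Set (EuclideanSpace ℝ (Fin n))) : ℝ≥0∞ :=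
  sInf {c | ∃ u : EuclideanSpace ℝ (Fin n) → ℝ,
    Continuous u ∧ HasCompactSupport u ∧ tsupport u ⊆ G ∧ (∀ x ∈ K, 1 ≤ u x) ∧
      c = fracSeminorm δ G u}

/-- The fractional `δ`-perimeter of `A` with respect to `G`. -/
noncomputable def fracPerimeter {n : ℕ} (δ : ℝ) (A G : Set (EuclideanSpace ℝ (Fin n))) : ℝ≥0∞ :=
  ∫⁻ x in A, ∫⁻ y in G \ A, 1 / edist x y ^ ((n : ℝ) + δ)

/-- The point `(y, t) = (y₁, …, yₙ₋₁, t)` of `ℝⁿ = ℝⁿ⁻¹ × ℝ` (for `n ≥ 1`). -/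
noncomputable def joinLast {n : ℕ} (y : EuclideanSpace ℝ (Fin (n - 1))) (t : ℝ) :
    EuclideanSpace ℝ (Fin n) :=
  WithLp.toLp 2 fun i : Fin n => if h : i.val < n - 1 then y ⟨i.val, h⟩ else t

/-- `Γ` is an `(n-1)`-dimensional `C^∞`-manifold in the open set `G` (for `n ≥ 1`): a subset of `G`,
closed relative to `G`, such that every `x ∈ Γ` has a neighbourhood `ψ(U × V)`, with `U ⊆ ℝⁿ⁻¹` and
`V ⊆ ℝ` open and `ψ z = x + R (z - x)` a rotation about `x`, in which `Γ` is the `ψ`-image of the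
graph of a smooth function `g : U → V`. -/
def IsSmoothHypersurfaceIn {n : ℕ} (Γ G : Set (EuclideanSpace ℝ (Fin n))) : Prop :=
  Γ ⊆ G ∧ IsClosed (Subtype.val ⁻¹' Γ : Set G) ∧
    ∀ x ∈ Γ, ∃ (U : Set (EuclideanSpace ℝ (Fin (n - 1)))) (V : Set ℝ)
      (g : EuclideanSpace ℝ (Fin (n - 1)) → ℝ)
      (R : EuclideanSpace ℝ (Fin n) ≃ₗᵢ[ℝ] EuclideanSpace ℝ (Fin n))
      (ψ : EuclideanSpace ℝ (Fin n) → EuclideanSpace ℝ (Fin n)),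
      IsOpen U ∧ IsOpen V ∧ ContDiffOn ℝ ∞ g U ∧ MapsTo g U V ∧
      LinearMap.det (R.toLinearEquiv : EuclideanSpace ℝ (Fin n) →ₗ[ℝ] EuclideanSpace ℝ (Fin n)) = 1 ∧
      (∀ z, ψ z = x + R (z - x)) ∧
      x ∈ ψ '' image2 joinLast U V ∧
      Γ ∩ ψ '' image2 joinLast U V = (fun y => ψ (joinLast y (g y))) '' U

open Filter Topology

/-! The engine is a coarea formula. Since |u(x) - u(y)| is the length of the set of levels
separating u(x) from u(y), Tonelli writes the seminorm of u as the integral over t of the seminorms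
of the indicators of {u > t} (`fracSeminorm_eq_lintegral_superlevel`), and the seminorm of an
indicator is twice a perimeter (`fracSeminorm_indicator`).

(A) gives (B) and (C) by testing with admissible functions and with indicators. Conversely, (B) and
(C) each give the weak-type bound s |{f ≥ s}|^((n-δ)/n) ≤ C · seminorm(f) for smooth compactly
supported f and s > 0. From (B) this is scaling (`measure_superlevel_rpow_le_of_isocapacitary`).
From (C) one integrates over the levels of a slightly tilted f, almost all of whose relevant
superlevel sets have smooth boundary (`measure_superlevel_rpow_le_of_isoperimetric`).

The weak bound, applied to mollified indicators with s → 1, yields the isoperimetric inequality for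
every measurable set inside a compact subset of G, with no loss in the constant
(`measure_rpow_le_fracSeminorm_indicator`). Mollification does not increase the seminorm over the
whole space; the interaction with the complement of G is finite in the limit and is removed by
Fatou. Minkowski's inequality for the layer-cake representation, combined with the coarea formula,
then gives (A) (`lintegral_rpow_le_fracSeminorm_of_indicator`). -/

/-! ### Indicators and the coarea formula. -/

theorem measurable_fracSeminorm_integrand {n : ℕ} (p : ℝ) {u : EuclideanSpace ℝ (Fin n) → ℝ}
    (hu : Measurable u) :
    Measurable (fun z : EuclideanSpace ℝ (Fin n) × EuclideanSpace ℝ (Fin n) =>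
      ‖u z.1 - u z.2‖ₑ / edist z.1 z.2 ^ p) := by
  have h1 : Measurable fun z : EuclideanSpace ℝ (Fin n) × EuclideanSpace ℝ (Fin n) => u z.1 :=
    hu.comp measurable_fst
  have h2 : Measurable fun z : EuclideanSpace ℝ (Fin n) × EuclideanSpace ℝ (Fin n) => u z.2 :=
    hu.comp measurable_snd
  exact (h1.sub h2).enorm.div (measurable_edist.pow_const _)

theorem measurable_inv_edist_rpow {n : ℕ} (p : ℝ) :
    Measurable (fun z : EuclideanSpace ℝ (Fin n) × EuclideanSpace ℝ (Fin n) =>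
      1 / edist z.1 z.2 ^ p) :=
  measurable_const.div (measurable_edist.pow_const _)

/-- Only pairs with exactly one point in D contribute, and by symmetry of the kernel the two orders
contribute equally. This factor is the source of the 2C in (C). -/
theorem fracSeminorm_indicator {n : ℕ} (δ : ℝ) {D G : Set (EuclideanSpace ℝ (Fin n))}
    (hD : MeasurableSet D) (hDG : D ⊆ G) (hG : MeasurableSet G) :
    fracSeminorm δ G (D.indicator 1) = 2 * fracPerimeter δ D G := by
  set p : ℝ := (n : ℝ) + δ
  have hu : Measurable (D.indicator (1 : EuclideanSpace ℝ (Fin n) → ℝ)) :=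
    measurable_one.indicator hD
  have hGD : G ∩ D = D := inter_eq_right.2 hDG
  have h1 : ∀ x ∈ D, ∫⁻ y in G, ‖D.indicator (1 : EuclideanSpace ℝ (Fin n) → ℝ) x -
      D.indicator (1 : EuclideanSpace ℝ (Fin n) → ℝ) y‖ₑ / edist x y ^ p =
      ∫⁻ y in G \ D, 1 / edist x y ^ p := by
    intro x hx
    rw [← lintegral_inter_add_sdiff _ G hD, hGD,
      setLIntegral_congr_fun (g := fun _ => 0) hD, lintegral_zero, zero_add]
    · refine setLIntegral_congr_fun (hG.diff hD) fun y hy => ?_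
      simp [hx, hy.2]
    · intro y hy
      simp [hx, hy]
  have h2 : ∀ x ∈ G \ D, ∫⁻ y in G, ‖D.indicator (1 : EuclideanSpace ℝ (Fin n) → ℝ) x -
      D.indicator (1 : EuclideanSpace ℝ (Fin n) → ℝ) y‖ₑ / edist x y ^ p =
      ∫⁻ y in D, 1 / edist x y ^ p := by
    intro x hx
    rw [← lintegral_inter_add_sdiff _ G hD, hGD,
      setLIntegral_congr_fun (s := G \ D) (g := fun _ => 0) (hG.diff hD), lintegral_zero, add_zero]
    · refine setLIntegral_congr_fun hD fun y hy => ?_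
      simp [hx.2, hy]
    · intro y hy
      simp [hx.2, hy.2]
  rw [fracSeminorm, ← lintegral_inter_add_sdiff _ G hD, hGD, setLIntegral_congr_fun hD h1,
    setLIntegral_congr_fun (hG.diff hD) h2, two_mul, fracPerimeter]
  congr 1
  rw [lintegral_lintegral_swap]
  · exact lintegral_congr fun x => lintegral_congr fun y => by rw [edist_comm]
  · exact (measurable_inv_edist_rpow p).aemeasurable

/-- The integrand is the indicator of the interval [min a b, max a b). -/
theorem enorm_sub_eq_lintegral_Ioi_indicator (a b : ℝ) :
    ‖a - b‖ₑ = ∫⁻ t : ℝ, ‖(Iio a).indicator (1 : ℝ → ℝ) t - (Iio b).indicator (1 : ℝ → ℝ) t‖ₑ := by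
  have h : ∀ t : ℝ, ‖(Iio a).indicator (1 : ℝ → ℝ) t - (Iio b).indicator (1 : ℝ → ℝ) t‖ₑ =
      (Ico (min a b) (max a b)).indicator 1 t := by
    intro t
    by_cases ha : t < a <;> by_cases hb : t < b <;>
      simp [indicator, ha, hb, not_lt.1]
  rw [lintegral_congr h, lintegral_indicator_one measurableSet_Ico, Real.volume_Ico,
    max_sub_min_eq_abs', Real.enorm_eq_ofReal_abs]

theorem fracSeminorm_eq_lintegral_superlevel {n : ℕ} (δ : ℝ) (G : Set (EuclideanSpace ℝ (Fin n)))
    {u : EuclideanSpace ℝ (Fin n) → ℝ} (hu : Measurable u) :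
    fracSeminorm δ G u = ∫⁻ t : ℝ, fracSeminorm δ G ({x | t < u x}.indicator 1) := by
  set p : ℝ := (n : ℝ) + δ
  have hs1 : MeasurableSet {z : (EuclideanSpace ℝ (Fin n) × ℝ) × EuclideanSpace ℝ (Fin n) |
      z.1.2 < u z.1.1} :=
    measurableSet_lt (measurable_snd.comp measurable_fst) (hu.comp (measurable_fst.comp measurable_fst))
  have hs2 : MeasurableSet {z : (EuclideanSpace ℝ (Fin n) × ℝ) × EuclideanSpace ℝ (Fin n) |
      z.1.2 < u z.2} :=
    measurableSet_lt (measurable_snd.comp measurable_fst) (hu.comp measurable_snd)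
  have hm : Measurable (fun z : (EuclideanSpace ℝ (Fin n) × ℝ) × EuclideanSpace ℝ (Fin n) =>
      ‖{x | z.1.2 < u x}.indicator (1 : EuclideanSpace ℝ (Fin n) → ℝ) z.1.1 -
        {x | z.1.2 < u x}.indicator (1 : EuclideanSpace ℝ (Fin n) → ℝ) z.2‖ₑ /
          edist z.1.1 z.2 ^ p) := by
    refine (Measurable.enorm (Measurable.sub ?_ ?_)).div
      ((measurable_edist.comp ((measurable_fst.comp measurable_fst).prodMk measurable_snd)).pow_const _)
    · exact (measurable_one (α := ℝ)).indicator hs1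
    · exact (measurable_one (α := ℝ)).indicator hs2
  have key : ∀ x y : EuclideanSpace ℝ (Fin n), ‖u x - u y‖ₑ / edist x y ^ p =
      ∫⁻ t : ℝ, ‖{x | t < u x}.indicator (1 : EuclideanSpace ℝ (Fin n) → ℝ) x -
        {x | t < u x}.indicator (1 : EuclideanSpace ℝ (Fin n) → ℝ) y‖ₑ / edist x y ^ p := by
    intro x y
    simp_rw [div_eq_mul_inv]
    rw [lintegral_mul_const, enorm_sub_eq_lintegral_Ioi_indicator]
    · rfl
    · refine (Measurable.sub ?_ ?_).enorm
      · exact (measurable_one (α := ℝ) (β := ℝ)).indicator (measurableSet_Iio (a := u x))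
      · exact (measurable_one (α := ℝ) (β := ℝ)).indicator (measurableSet_Iio (a := u y))
  unfold fracSeminorm
  simp_rw [show (n : ℝ) + δ = p from rfl, key]
  calc _ = ∫⁻ x in G, ∫⁻ t : ℝ, ∫⁻ y in G,
        ‖{x | t < u x}.indicator (1 : EuclideanSpace ℝ (Fin n) → ℝ) x -
          {x | t < u x}.indicator (1 : EuclideanSpace ℝ (Fin n) → ℝ) y‖ₑ / edist x y ^ p := by
        refine lintegral_congr fun x => lintegral_lintegral_swap ?_
        exact (hm.comp ((measurable_const.prodMk measurable_snd).prodMk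
          measurable_fst)).aemeasurable
    _ = _ := lintegral_lintegral_swap (Measurable.lintegral_prod_right
          (f := fun z : EuclideanSpace ℝ (Fin n) × ℝ => fun y =>
            ‖{x | z.2 < u x}.indicator (1 : EuclideanSpace ℝ (Fin n) → ℝ) z.1 -
          {x | z.2 < u x}.indicator (1 : EuclideanSpace ℝ (Fin n) → ℝ) y‖ₑ / edist z.1 y ^ p)
          hm).aemeasurable

/-! ### Minkowski's inequality for superlevel sets. -/

theorem lintegral_ite_ofReal_lt (a : ℝ≥0∞) :
    ∫⁻ t in Ioi (0 : ℝ), (if ENNReal.ofReal t < a then 1 else 0 : ℝ≥0∞) = a := by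
  have h : ∀ t : ℝ, (if ENNReal.ofReal t < a then 1 else 0 : ℝ≥0∞) =
      {t : ℝ | ENNReal.ofReal t < a}.indicator 1 t := fun t => by simp [indicator]
  simp_rw [h]
  rw [lintegral_indicator_one (measurableSet_lt ENNReal.measurable_ofReal measurable_const),
    Measure.restrict_apply (measurableSet_lt ENNReal.measurable_ofReal measurable_const)]
  rcases eq_or_ne a ⊤ with rfl | ha
  · simp
  · have : {t : ℝ | ENNReal.ofReal t < a} ∩ Ioi 0 = Ioo 0 a.toReal := by
      ext t
      simp only [mem_inter_iff, mem_ofPred_eq, mem_Ioi, mem_Ioo]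
      constructor
      · rintro ⟨h1, h2⟩
        exact ⟨h2, (ENNReal.ofReal_lt_iff_lt_toReal h2.le ha).1 h1⟩
      · rintro ⟨h1, h2⟩
        exact ⟨(ENNReal.ofReal_lt_iff_lt_toReal h1.le ha).2 h2, h1⟩
    rw [this]
    simp [ha]

section
variable {α : Type*} [MeasurableSpace α]

/-- Write f^q as the integral over t > 0 of 1_{t < f} f^(q-1), apply Hölder in x for each t with
exponents q and q/(q-1), and cancel A^(1 - 1/q). The cancellation is what requires A to be finite.
-/
theorem lintegral_rpow_le_lintegral_measure_rpow_of_ne_top (μ : Measure α) [SFinite μ] {q : ℝ}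
    (hq : 1 < q) {f : α → ℝ≥0∞} (hf : Measurable f) (hfin : ∫⁻ x, f x ^ q ∂μ ≠ ⊤) :
    (∫⁻ x, f x ^ q ∂μ) ^ (1 / q) ≤
      ∫⁻ t in Ioi (0 : ℝ), μ {x | ENNReal.ofReal t < f x} ^ (1 / q) := by
  set A := ∫⁻ x, f x ^ q ∂μ
  have hq0 : 0 < q := by linarith
  rcases eq_or_ne A 0 with hA | hA
  · rw [hA, ENNReal.zero_rpow_of_pos (by positivity)]; exact zero_le
  have hset : ∀ t : ℝ, MeasurableSet {x | ENNReal.ofReal t < f x} := fun t =>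
    measurableSet_lt measurable_const hf
  have hm : Measurable fun z : α × ℝ =>
      (if ENNReal.ofReal z.2 < f z.1 then 1 else 0 : ℝ≥0∞) * f z.1 ^ (q - 1) := by
    refine Measurable.mul (Measurable.ite (measurableSet_lt ?_ ?_) ?_ ?_) ?_
    · exact ENNReal.measurable_ofReal.comp measurable_snd
    · exact hf.comp measurable_fst
    · exact measurable_const
    · exact measurable_const
    · exact (hf.comp measurable_fst).pow_const _
  have h1 : A = ∫⁻ t in Ioi (0 : ℝ), ∫⁻ x,
      (if ENNReal.ofReal t < f x then 1 else 0 : ℝ≥0∞) * f x ^ (q - 1) ∂μ := by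
    rw [← lintegral_lintegral_swap (f := fun x t =>
      (if ENNReal.ofReal t < f x then 1 else 0 : ℝ≥0∞) * f x ^ (q - 1)) hm.aemeasurable]
    refine lintegral_congr fun x => ?_
    rw [lintegral_mul_const, lintegral_ite_ofReal_lt]
    · rcases eq_or_ne (f x) 0 with h | h
      · rw [h, ENNReal.zero_rpow_of_pos hq0, zero_mul]
      rcases eq_or_ne (f x) ⊤ with h' | h'
      · rw [h', ENNReal.top_rpow_of_pos hq0, ENNReal.top_rpow_of_pos (by linarith)]; rfl
      · rw [ENNReal.rpow_sub _ _ h h', ENNReal.rpow_one, ENNReal.mul_div_cancel h h']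
    · exact Measurable.ite (measurableSet_lt ENNReal.measurable_ofReal measurable_const)
        measurable_const measurable_const
  have hpq : q.HolderConjugate (q / (q - 1)) := Real.HolderConjugate.conjExponent hq
  have h2 : ∀ t : ℝ, ∫⁻ x, (if ENNReal.ofReal t < f x then 1 else 0 : ℝ≥0∞) * f x ^ (q - 1) ∂μ ≤
      μ {x | ENNReal.ofReal t < f x} ^ (1 / q) * A ^ (1 - 1 / q) := by
    intro t
    have hi : Measurable fun x => (if ENNReal.ofReal t < f x then 1 else 0 : ℝ≥0∞) :=
      Measurable.ite (hset t) measurable_const measurable_const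
    refine (ENNReal.lintegral_mul_le_Lp_mul_Lq μ hpq hi.aemeasurable
      (hf.pow_const (q - 1)).aemeasurable).trans_eq ?_
    congr 1
    · congr 1
      rw [← lintegral_indicator_one (hset t)]
      refine lintegral_congr fun x => ?_
      by_cases h : ENNReal.ofReal t < f x <;> simp [h, hq0]
    · have h3 : q - 1 ≠ 0 := by linarith
      congr 1
      · refine lintegral_congr fun x => ?_
        rw [← ENNReal.rpow_mul, mul_div_cancel₀ _ h3]
      · field_simp
  have h3 : A ≤ (∫⁻ t in Ioi (0 : ℝ), μ {x | ENNReal.ofReal t < f x} ^ (1 / q)) *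
      A ^ (1 - 1 / q) := by
    calc A ≤ ∫⁻ t in Ioi (0 : ℝ), μ {x | ENNReal.ofReal t < f x} ^ (1 / q) * A ^ (1 - 1 / q) := by
          rw [h1]; exact lintegral_mono fun t => h1 ▸ h2 t
      _ = _ := by
          rw [lintegral_mul_const']
          refine ENNReal.rpow_ne_top_of_nonneg ?_ hfin
          rw [sub_nonneg, div_le_one hq0]; exact hq.le
  have h4 : A = A ^ (1 / q) * A ^ (1 - 1 / q) := by
    rw [← ENNReal.rpow_add _ _ hA hfin]; simp
  have hq1 : 0 ≤ 1 - 1 / q := by rw [sub_nonneg, div_le_one hq0]; exact hq.le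
  have h5 : A ^ (1 - 1 / q) ≠ 0 := by simp [hA, hfin]
  have h6 : A ^ (1 - 1 / q) ≠ ⊤ := ENNReal.rpow_ne_top_of_nonneg hq1 hfin
  exact (ENNReal.mul_le_mul_iff_left h5 h6).1 (h4 ▸ h3)

/-- The `L^q` norm is at most the integral of the `L^q` norms of the indicators of the superlevel
sets (Minkowski's inequality applied to the layer-cake representation). -/
theorem lintegral_rpow_le_lintegral_measure_rpow (μ : Measure α) [IsFiniteMeasure μ] {q : ℝ}
    (hq : 1 < q) {f : α → ℝ≥0∞} (hf : Measurable f) (hfin : ∀ x, f x ≠ ⊤) :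
    (∫⁻ x, f x ^ q ∂μ) ^ (1 / q) ≤
      ∫⁻ t in Ioi (0 : ℝ), μ {x | ENNReal.ofReal t < f x} ^ (1 / q) := by
  have hq0 : 0 < q := by linarith
  -- On a finite measure space the truncations min(f, k) have finite q-integral; since f is finite
  -- everywhere they eventually equal f at each point, and monotone convergence applies.
  have hmono : Monotone fun (k : ℕ) (x : α) => min (f x) k ^ q := fun i j hij x =>
    ENNReal.rpow_le_rpow (min_le_min le_rfl (by exact_mod_cast hij)) hq0.le
  have hsup : ∀ x, ⨆ k : ℕ, min (f x) k ^ q = f x ^ q := by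
    intro x
    obtain ⟨k, hk⟩ := ENNReal.exists_nat_gt (hfin x)
    refine le_antisymm (iSup_le fun k => ENNReal.rpow_le_rpow (min_le_left _ _) hq0.le) ?_
    exact le_iSup_of_le k (by rw [min_eq_left hk.le])
  have hlim : ∫⁻ x, f x ^ q ∂μ = ⨆ k : ℕ, ∫⁻ x, min (f x) k ^ q ∂μ := by
    rw [← lintegral_iSup (fun k => (hf.min measurable_const).pow_const q) hmono]
    simp_rw [hsup]
  rw [hlim, one_div, ENNReal.rpow_inv_le_iff hq0]
  refine iSup_le fun k => ?_
  rw [← ENNReal.rpow_inv_le_iff hq0, ← one_div]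
  refine (lintegral_rpow_le_lintegral_measure_rpow_of_ne_top μ hq
    (hf.min measurable_const) ?_).trans ?_
  · refine ((lintegral_mono fun x => ENNReal.rpow_le_rpow (min_le_right (f x) k) hq0.le).trans_lt
      ?_).ne
    rw [lintegral_const]
    exact ENNReal.mul_lt_top (ENNReal.rpow_lt_top_of_nonneg hq0.le (ENNReal.natCast_ne_top k))
      (measure_lt_top μ _)
  · refine lintegral_mono fun t => ENNReal.rpow_le_rpow (measure_mono fun x hx => ?_)
      (by positivity)
    exact lt_of_lt_of_le (show ENNReal.ofReal t < min (f x) k from hx) (min_le_left _ _)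
end

/-! ### Comparison with the whole space and kernel estimates. -/

/-- Pairs outside G contribute nothing, and the two kinds of mixed pairs contribute equally. The
identity transfers seminorm bounds on the whole space, where translations act, back to G. -/
theorem fracSeminorm_univ_eq_add {n : ℕ} (δ : ℝ) {G : Set (EuclideanSpace ℝ (Fin n))}
    (hG : MeasurableSet G) {u : EuclideanSpace ℝ (Fin n) → ℝ} (hu : Measurable u)
    (huG : ∀ x ∉ G, u x = 0) :
    fracSeminorm δ univ u = fracSeminorm δ G u +
      2 * ∫⁻ x in G, ‖u x‖ₑ * ∫⁻ y in Gᶜ, 1 / edist x y ^ ((n : ℝ) + δ) := by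
  set p : ℝ := (n : ℝ) + δ with hp
  have hm := measurable_fracSeminorm_integrand p hu
  have hk := measurable_inv_edist_rpow (n := n) p
  have hmul : ∀ x, ‖u x‖ₑ * ∫⁻ y in Gᶜ, 1 / edist x y ^ p =
      ∫⁻ y in Gᶜ, ‖u x‖ₑ * (1 / edist x y ^ p) := fun x =>
    (lintegral_const_mul _ (hk.comp measurable_prodMk_left)).symm
  have h1 : ∀ x ∈ G, ∫⁻ y in Gᶜ, ‖u x - u y‖ₑ / edist x y ^ p =
      ‖u x‖ₑ * ∫⁻ y in Gᶜ, 1 / edist x y ^ p := by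
    intro x _
    rw [hmul]
    refine setLIntegral_congr_fun hG.compl fun y hy => ?_
    simp [huG y hy, div_eq_mul_inv]
  have h2 : ∀ x ∈ Gᶜ, ∫⁻ y, ‖u x - u y‖ₑ / edist x y ^ p =
      ∫⁻ y in G, ‖u y‖ₑ * (1 / edist y x ^ p) := by
    intro x hx
    rw [← lintegral_add_compl _ hG, setLIntegral_congr_fun (s := Gᶜ) (g := fun _ => 0) hG.compl,
      lintegral_zero, add_zero]
    · refine setLIntegral_congr_fun hG fun y _ => ?_
      simp [huG x hx, div_eq_mul_inv, edist_comm]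
    · intro y hy
      simp [huG x hx, huG y hy]
  unfold fracSeminorm
  rw [← hp, Measure.restrict_univ, ← lintegral_add_compl _ hG, setLIntegral_congr_fun hG.compl h2]
  have h3 : ∫⁻ x in G, ∫⁻ y, ‖u x - u y‖ₑ / edist x y ^ p =
      (∫⁻ x in G, ∫⁻ y in G, ‖u x - u y‖ₑ / edist x y ^ p) +
        ∫⁻ x in G, ‖u x‖ₑ * ∫⁻ y in Gᶜ, 1 / edist x y ^ p := by
    rw [← lintegral_add_left hm.lintegral_prod_right']
    refine setLIntegral_congr_fun hG fun x hx => ?_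
    simp only
    rw [← lintegral_add_compl _ hG, h1 x hx]
  rw [h3, two_mul, add_assoc]
  congr 2
  rw [lintegral_lintegral_swap]
  · exact lintegral_congr fun x => (hmul x).symm
  · exact (((hu.comp measurable_snd).enorm).mul
      (hk.comp (measurable_snd.prodMk measurable_fst))).aemeasurable

/-- The value of the integral of the kernel `min |z| 1 / |z| ^ (n + δ)`. -/
noncomputable def kernelMass (n : ℕ) (δ : ℝ) : ℝ≥0∞ :=
  ∫⁻ z : EuclideanSpace ℝ (Fin n), min ‖z‖ₑ 1 / ‖z‖ₑ ^ ((n : ℝ) + δ)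

/-- In polar coordinates the radial integrand is r^(-δ) on (0, 1], integrable as δ < 1, and r^(-1-δ)
on (1, ∞), integrable as δ > 0. -/
theorem kernelMass_lt_top {n : ℕ} (hn : 1 ≤ n) {δ : ℝ} (hδ0 : 0 < δ) (hδ1 : δ < 1) :
    kernelMass n δ < ⊤ := by
  have : Nontrivial (EuclideanSpace ℝ (Fin n)) := by
    have : Nonempty (Fin n) := ⟨⟨0, hn⟩⟩
    infer_instance
  set p : ℝ := (n : ℝ) + δ with hp
  have hreal : IntegrableOn (fun y : ℝ => y ^ (n - 1) • (min y 1 * y ^ (-p))) (Ioi 0) := by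
    have hpow : ∀ y : ℝ, 0 < y → y ^ (n - 1) = y ^ ((n : ℝ) - 1) := by
      intro y hy
      rw [← Real.rpow_natCast, Nat.cast_sub hn, Nat.cast_one]
    rw [← Ioc_union_Ioi_eq_Ioi zero_le_one]
    refine IntegrableOn.union ?_ ?_
    · have h : IntegrableOn (fun y : ℝ => y ^ (-δ)) (Ioc 0 1) := by
        rw [← intervalIntegrable_iff_integrableOn_Ioc_of_le zero_le_one]
        exact intervalIntegral.intervalIntegrable_rpow' (by linarith)
      refine h.congr_fun (fun y hy => ?_) measurableSet_Ioc
      simp only [smul_eq_mul]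
      rw [min_eq_left hy.2, hpow y hy.1]
      nth_rw 3 [← Real.rpow_one y]
      rw [← Real.rpow_add hy.1, ← Real.rpow_add hy.1]
      congr 1; rw [hp]; ring
    · have h : IntegrableOn (fun y : ℝ => y ^ (-1 - δ)) (Ioi 1) :=
        integrableOn_Ioi_rpow_of_lt (by linarith) zero_lt_one
      refine h.congr_fun (fun y hy => ?_) measurableSet_Ioi
      have hy0 : (0 : ℝ) < y := zero_lt_one.trans hy
      simp only [smul_eq_mul]
      rw [min_eq_right (le_of_lt hy), hpow y hy0, one_mul, ← Real.rpow_add hy0]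
      congr 1; rw [hp]; ring
  have hint := (integrable_fun_norm_addHaar (volume : Measure (EuclideanSpace ℝ (Fin n)))
    (f := fun y : ℝ => min y 1 * y ^ (-p))).2 (by simpa using hreal)
  refine lt_of_le_of_lt (lintegral_mono fun z => ?_) hint.2
  rcases eq_or_ne z 0 with rfl | hz
  · simp
  have hz' : 0 < ‖z‖ := norm_pos_iff.2 hz
  rw [Real.enorm_of_nonneg (by positivity), ENNReal.ofReal_mul (by positivity),
    Real.rpow_neg hz'.le, ENNReal.ofReal_inv_of_pos (by positivity),
    ← ENNReal.ofReal_rpow_of_pos hz', ofReal_norm, div_eq_mul_inv,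
    ← ENNReal.ofReal_one, ← ofReal_norm, ENNReal.ofReal_min]

theorem lintegral_min_edist_div {n : ℕ} (δ : ℝ) (x : EuclideanSpace ℝ (Fin n)) :
    ∫⁻ y, min (edist x y) 1 / edist x y ^ ((n : ℝ) + δ) = kernelMass n δ := by
  simp_rw [edist_eq_enorm_sub]
  exact lintegral_sub_left_eq_self (fun z => min ‖z‖ₑ 1 / ‖z‖ₑ ^ ((n : ℝ) + δ)) x

theorem measurable_min_edist_div_right {n : ℕ} (p : ℝ) (x : EuclideanSpace ℝ (Fin n)) :
    Measurable (fun y : EuclideanSpace ℝ (Fin n) => min (edist x y) 1 / edist x y ^ p) :=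
  have h : Measurable fun y : EuclideanSpace ℝ (Fin n) => edist x y :=
    measurable_edist.comp measurable_prodMk_left
  (h.min measurable_const).div (h.pow_const _)

theorem measurable_min_edist_div {n : ℕ} (p : ℝ) :
    Measurable (fun z : EuclideanSpace ℝ (Fin n) × EuclideanSpace ℝ (Fin n) =>
      min (edist z.1 z.2) 1 / edist z.1 z.2 ^ p) :=
  (measurable_edist.min measurable_const).div (measurable_edist.pow_const _)

/-- The two indicator terms contribute equally by symmetry; each is the volume of B times the kernel
mass, by translation invariance. -/
theorem fracSeminorm_le_of_enorm_sub_le {n : ℕ} (δ : ℝ) (G : Set (EuclideanSpace ℝ (Fin n)))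
    {B : Set (EuclideanSpace ℝ (Fin n))} (hB : MeasurableSet B) (c : ℝ≥0∞)
    {u : EuclideanSpace ℝ (Fin n) → ℝ}
    (hu : ∀ x y, ‖u x - u y‖ₑ ≤ c * ((B.indicator 1 x + B.indicator 1 y) * min (edist x y) 1)) :
    fracSeminorm δ G u ≤ c * (2 * (volume B * kernelMass n δ)) := by
  set p : ℝ := (n : ℝ) + δ with hp
  have hk := measurable_min_edist_div (n := n) p
  have h1 : ∫⁻ x, ∫⁻ y, B.indicator 1 x * (min (edist x y) 1 / edist x y ^ p) =
      volume B * kernelMass n δ := by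
    have : ∀ x, ∫⁻ y, B.indicator 1 x * (min (edist x y) 1 / edist x y ^ p) =
        B.indicator 1 x * kernelMass n δ := fun x => by
      rw [lintegral_const_mul _ (measurable_min_edist_div_right p x), lintegral_min_edist_div]
    simp_rw [this]
    rw [lintegral_mul_const _ (measurable_one.indicator hB), lintegral_indicator_one hB]
  have hmx : Measurable (fun z : EuclideanSpace ℝ (Fin n) × EuclideanSpace ℝ (Fin n) =>
      B.indicator (1 : EuclideanSpace ℝ (Fin n) → ℝ≥0∞) z.1 *
        (min (edist z.1 z.2) 1 / edist z.1 z.2 ^ p)) :=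
    ((measurable_one.indicator hB).comp measurable_fst).mul hk
  have hmy : Measurable (fun z : EuclideanSpace ℝ (Fin n) × EuclideanSpace ℝ (Fin n) =>
      B.indicator (1 : EuclideanSpace ℝ (Fin n) → ℝ≥0∞) z.2 *
        (min (edist z.1 z.2) 1 / edist z.1 z.2 ^ p)) :=
    ((measurable_one.indicator hB).comp measurable_snd).mul hk
  have h2 : ∫⁻ x, ∫⁻ y, B.indicator 1 y * (min (edist x y) 1 / edist x y ^ p) =
      volume B * kernelMass n δ := by
    rw [← h1, lintegral_lintegral_swap hmy.aemeasurable]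
    exact lintegral_congr fun x => lintegral_congr fun y => by rw [edist_comm]
  calc fracSeminorm δ G u
      ≤ ∫⁻ x, ∫⁻ y, ‖u x - u y‖ₑ / edist x y ^ p :=
        (setLIntegral_le_lintegral _ _).trans
          (lintegral_mono fun x => setLIntegral_le_lintegral _ _)
    _ ≤ ∫⁻ x, ∫⁻ y, c * (B.indicator 1 x * (min (edist x y) 1 / edist x y ^ p) +
          B.indicator 1 y * (min (edist x y) 1 / edist x y ^ p)) := by
        refine lintegral_mono fun x => lintegral_mono fun y => ?_
        refine (ENNReal.div_le_div_right (hu x y) _).trans_eq ?_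
        simp only [div_eq_mul_inv]; ring
    _ = c * ((∫⁻ x, ∫⁻ y, B.indicator 1 x * (min (edist x y) 1 / edist x y ^ p)) +
          ∫⁻ x, ∫⁻ y, B.indicator 1 y * (min (edist x y) 1 / edist x y ^ p)) := by
        have hX : Measurable fun x => ∫⁻ y, B.indicator (1 : EuclideanSpace ℝ (Fin n) → ℝ≥0∞) x *
            (min (edist x y) 1 / edist x y ^ p) := hmx.lintegral_prod_right'
        have hY : Measurable fun x => ∫⁻ y, B.indicator (1 : EuclideanSpace ℝ (Fin n) → ℝ≥0∞) y *
            (min (edist x y) 1 / edist x y ^ p) := hmy.lintegral_prod_right'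
        rw [← lintegral_add_left hX]
        refine Eq.trans (lintegral_congr fun x => ?_) (lintegral_const_mul _ (hX.add hY))
        have hx := (measurable_min_edist_div_right p x).const_mul (B.indicator 1 x)
        have hy := (measurable_one.indicator hB).mul (measurable_min_edist_div_right p x)
        rw [← lintegral_add_left hx]
        exact lintegral_const_mul _ (hx.add hy)
    _ = _ := by rw [h1, h2, two_mul]

/-- K has positive distance from the complement of G, so there the kernel is at most a constant
times the integrable kernel of `kernelMass`. -/
theorem lintegral_kernel_compl_lt_top {n : ℕ} (hn : 1 ≤ n) {δ : ℝ} (hδ0 : 0 < δ) (hδ1 : δ < 1)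
    {K G : Set (EuclideanSpace ℝ (Fin n))} (hK : IsCompact K) (hG : IsOpen G) (hKG : K ⊆ G) :
    ∫⁻ x in K, ∫⁻ y in Gᶜ, 1 / edist x y ^ ((n : ℝ) + δ) < ⊤ := by
  obtain ⟨r, hr, hrG⟩ := hK.exists_cthickening_subset_open hG hKG
  set c : ℝ≥0∞ := min (ENNReal.ofReal r) 1 with hc
  have hc0 : c ≠ 0 := by simp [hc, hr]
  have hctop : c ≠ ⊤ := (lt_of_le_of_lt (min_le_right _ _) ENNReal.one_lt_top).ne
  have hle : ∀ x ∈ K, ∫⁻ y in Gᶜ, 1 / edist x y ^ ((n : ℝ) + δ) ≤ c⁻¹ * kernelMass n δ := by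
    intro x hx
    rw [← lintegral_min_edist_div δ x, ← lintegral_const_mul _
      (measurable_min_edist_div_right _ x)]
    refine (setLIntegral_mono' hG.measurableSet.compl fun y hy => ?_).trans
      (setLIntegral_le_lintegral _ _)
    have hd : c ≤ min (edist x y) 1 := by
      refine min_le_min ?_ le_rfl
      by_contra! h
      refine hy (hrG ?_)
      exact Metric.mem_cthickening_of_edist_le y x r K hx (by rw [edist_comm]; exact h.le)
    simp only [← mul_div_assoc]
    refine ENNReal.div_le_div_right ?_ _
    calc (1 : ℝ≥0∞) = c⁻¹ * c := (ENNReal.inv_mul_cancel hc0 hctop).symm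
      _ ≤ _ := by gcongr
  calc _ ≤ ∫⁻ x in K, c⁻¹ * kernelMass n δ := setLIntegral_mono' hK.measurableSet hle
    _ < ⊤ := by
      rw [lintegral_const, Measure.restrict_apply_univ]
      exact ENNReal.mul_lt_top (ENNReal.mul_lt_top (ENNReal.inv_lt_top.2 (pos_iff_ne_zero.2 hc0))
        (kernelMass_lt_top hn hδ0 hδ1)) hK.measure_lt_top

/-! ### Mollification. -/

theorem lintegral_lintegral_lintegral_translate {n : ℕ} {a : EuclideanSpace ℝ (Fin n) → ℝ≥0∞}
    (ha : Measurable a)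
    {F : EuclideanSpace ℝ (Fin n) → EuclideanSpace ℝ (Fin n) → ℝ≥0∞}
    (hF : Measurable (Function.uncurry F)) :
    ∫⁻ x, ∫⁻ y, ∫⁻ t, a t * F (x - t) (y - t) = (∫⁻ t, a t) * ∫⁻ x, ∫⁻ y, F x y := by
  have hFx : ∀ x, Measurable (F x) := fun x => hF.comp measurable_prodMk_left
  have hFX : Measurable fun x => ∫⁻ y, F x y := hF.lintegral_prod_right
  have hM : Measurable (Function.uncurry fun (z : EuclideanSpace ℝ (Fin n) ×
      EuclideanSpace ℝ (Fin n)) (y : EuclideanSpace ℝ (Fin n)) =>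
        a z.2 * F (z.1 - z.2) (y - z.2)) :=
    (ha.comp (measurable_snd.comp measurable_fst)).mul (hF.comp
      (((measurable_fst.comp measurable_fst).sub (measurable_snd.comp measurable_fst)).prodMk
        (measurable_snd.sub (measurable_snd.comp measurable_fst))))
  calc ∫⁻ x, ∫⁻ y, ∫⁻ t, a t * F (x - t) (y - t)
      = ∫⁻ x, ∫⁻ t, ∫⁻ y, a t * F (x - t) (y - t) := by
        refine lintegral_congr fun x => lintegral_lintegral_swap ?_
        exact (hM.comp ((measurable_const.prodMk measurable_snd).prodMk
          measurable_fst)).aemeasurable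
    _ = ∫⁻ t, ∫⁻ x, ∫⁻ y, a t * F (x - t) (y - t) :=
        lintegral_lintegral_swap hM.lintegral_prod_right.aemeasurable
    _ = ∫⁻ t, a t * ∫⁻ x, ∫⁻ y, F x y := by
        refine lintegral_congr fun t => ?_
        have h1 : ∀ x, ∫⁻ y, a t * F (x - t) (y - t) = a t * ∫⁻ y, F (x - t) y := fun x => by
          rw [lintegral_sub_right_eq_self (fun y => a t * F (x - t) y) t,
            lintegral_const_mul _ (hFx _)]
        simp_rw [h1]
        rw [lintegral_sub_right_eq_self (fun x => a t * ∫⁻ y, F x y) t,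
          lintegral_const_mul _ hFX]
    _ = _ := lintegral_mul_const _ ha

open scoped Convolution in
theorem enorm_convolution_sub_le {n : ℕ} {φ g : EuclideanSpace ℝ (Fin n) → ℝ}
    (hφg : ConvolutionExists φ g (ContinuousLinearMap.lsmul ℝ ℝ) volume)
    (x y : EuclideanSpace ℝ (Fin n)) :
    ‖(φ ⋆[ContinuousLinearMap.lsmul ℝ ℝ, volume] g) x -
      (φ ⋆[ContinuousLinearMap.lsmul ℝ ℝ, volume] g) y‖ₑ ≤
      ∫⁻ t, ‖φ t‖ₑ * ‖g (x - t) - g (y - t)‖ₑ := by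
  rw [convolution_def, convolution_def, ← integral_sub (hφg x) (hφg y)]
  refine (enorm_integral_le_lintegral_enorm _).trans_eq (lintegral_congr fun t => ?_)
  rw [ContinuousLinearMap.lsmul_apply, ContinuousLinearMap.lsmul_apply, ← smul_sub, enorm_smul]

open scoped Convolution in
-- A convolution is an average of translates, and the whole-space seminorm is convex and translation
-- invariant.
theorem fracSeminorm_univ_convolution_le {n : ℕ} (δ : ℝ) {φ g : EuclideanSpace ℝ (Fin n) → ℝ}
    (hφ : Measurable φ) (hφ1 : ∫⁻ t, ‖φ t‖ₑ = 1) (hg : Measurable g)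
    (hφg : ConvolutionExists φ g (ContinuousLinearMap.lsmul ℝ ℝ) volume) :
    fracSeminorm δ univ (φ ⋆[ContinuousLinearMap.lsmul ℝ ℝ, volume] g) ≤ fracSeminorm δ univ g := by
  have hm := measurable_fracSeminorm_integrand ((n : ℝ) + δ) hg
  have key := lintegral_lintegral_lintegral_translate hφ.enorm
    (F := fun x y => ‖g x - g y‖ₑ / edist x y ^ ((n : ℝ) + δ)) hm
  rw [hφ1, one_mul] at key
  unfold fracSeminorm
  rw [Measure.restrict_univ, ← key]
  refine lintegral_mono fun x => lintegral_mono fun y => ?_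
  refine (ENNReal.div_le_div_right (enorm_convolution_sub_le hφg x y) _).trans_eq ?_
  simp_rw [edist_sub_right, ← mul_div_assoc, div_eq_mul_inv]
  have hgt : ∀ z : EuclideanSpace ℝ (Fin n), Measurable fun t => g (z - t) := fun z =>
    hg.comp (measurable_const.sub measurable_id)
  exact (lintegral_mul_const _ (hφ.enorm.mul ((hgt x).sub (hgt y)).enorm)).symm

theorem ENNReal.liminf_add_liminf_le {u v : ℕ → ℝ≥0∞} :
    liminf u atTop + liminf v atTop ≤ liminf (fun k => u k + v k) atTop := by
  have hmono : ∀ w : ℕ → ℝ≥0∞, Monotone fun k => ⨅ i, ⨅ _ : i ≥ k, w i := fun w a b hab =>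
    le_iInf₂ fun i hi => iInf₂_le i (hab.trans hi)
  simp only [liminf_eq_iSup_iInf_of_nat]
  rw [ENNReal.iSup_add_iSup_of_monotone (hmono u) (hmono v)]
  exact iSup_mono fun k => le_iInf₂ fun i hi => add_le_add (iInf₂_le i hi) (iInf₂_le i hi)

/-- Mollifications of a bounded set `E`, approximating its indicator from the point of view of the
seminorm on the whole space. -/
theorem exists_smooth_approx_indicator {n : ℕ} (δ : ℝ)
    {E K G : Set (EuclideanSpace ℝ (Fin n))} (hE : MeasurableSet E) (hK : IsCompact K)
    (hEK : E ⊆ K) (hG : IsOpen G) (hKG : K ⊆ G) :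
    ∃ f : ℕ → EuclideanSpace ℝ (Fin n) → ℝ,
      (∀ k, ContDiff ℝ ∞ (f k)) ∧ (∀ k, HasCompactSupport (f k)) ∧ (∀ k, tsupport (f k) ⊆ G) ∧
      (∀ k x, 0 ≤ f k x) ∧
      (∀ k, fracSeminorm δ univ (f k) ≤ fracSeminorm δ univ (E.indicator 1)) ∧
      ∀ᵐ x, Tendsto (fun k => f k x) atTop (𝓝 (E.indicator 1 x)) := by
  obtain ⟨ρ, hρ, hρG⟩ := hK.exists_cthickening_subset_open hG hKG
  -- Radii at most ρ keep the supports in the closed ρ-thickening of K, inside G. The fixed ratio 2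
  -- of outer to inner radius is what the almost everywhere convergence requires.
  let φ : ℕ → ContDiffBump (0 : EuclideanSpace ℝ (Fin n)) := fun k =>
    { rIn := ρ / (k + 1) / 2
      rOut := ρ / (k + 1)
      rIn_pos := by positivity
      rIn_lt_rOut := half_lt_self (by positivity) }
  have hφle : ∀ k, (φ k).rOut ≤ ρ := fun k =>
    div_le_self hρ.le (by linarith [(Nat.cast_nonneg k : (0 : ℝ) ≤ k)])
  have hgm : Measurable (E.indicator (1 : EuclideanSpace ℝ (Fin n) → ℝ)) :=
    measurable_one.indicator hE
  have hgi : Integrable (E.indicator (1 : EuclideanSpace ℝ (Fin n) → ℝ)) := by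
    rw [integrable_indicator_iff hE]
    exact integrableOn_const ((measure_mono hEK).trans_lt hK.measure_lt_top).ne
  have hgl := hgi.locallyIntegrable
  let L := ContinuousLinearMap.lsmul ℝ ℝ (E := ℝ)
  have hsub : ∀ k, Function.support (convolution ((φ k).normed volume) (E.indicator 1) L volume) ⊆
      Metric.cthickening ρ K := by
    intro k x hx
    obtain ⟨a, ha, b, hb, rfl⟩ := support_convolution_subset L hx
    rw [(φ k).support_normed_eq] at ha
    refine Metric.mem_cthickening_of_dist_le _ b ρ K (hEK (support_indicator_subset hb)) ?_
    have ha' : ‖a‖ < (φ k).rOut := by simpa using ha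
    simpa [dist_eq_norm] using ha'.le.trans (hφle k)
  have htsub : ∀ k, tsupport (convolution ((φ k).normed volume) (E.indicator 1) L volume) ⊆
      Metric.cthickening ρ K := fun k => closure_minimal (hsub k) Metric.isClosed_cthickening
  refine ⟨fun k => convolution ((φ k).normed volume) (E.indicator 1) L volume, fun k => ?_,
    fun k => ?_, fun k => (htsub k).trans hρG, fun k x => ?_, fun k => ?_, ?_⟩
  · exact (φ k).hasCompactSupport_normed.contDiff_convolution_left L (φ k).contDiff_normed hgl
  · exact hK.cthickening.of_isClosed_subset (isClosed_tsupport _) (htsub k)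
  · refine integral_nonneg fun t => mul_nonneg ((φ k).nonneg_normed t) ?_
    exact indicator_nonneg (fun _ _ => zero_le_one) _
  · refine fracSeminorm_univ_convolution_le δ (φ k).continuous_normed.measurable ?_ hgm ?_
    · rw [← ofReal_integral_norm_eq_lintegral_enorm (φ k).integrable_normed]
      simp_rw [Real.norm_of_nonneg ((φ k).nonneg_normed _)]
      rw [(φ k).integral_normed, ENNReal.ofReal_one]
    · exact (φ k).hasCompactSupport_normed.convolutionExists_left L (φ k).continuous_normed hgl
  · refine ContDiffBump.ae_convolution_tendsto_right_of_locallyIntegrable (K := 2) ?_ ?_ hgl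
    · have := (tendsto_one_div_add_atTop_nhds_zero_nat (𝕜 := ℝ)).const_mul ρ
      simpa [φ, div_eq_mul_inv] using this
    · refine Eventually.of_forall fun k => le_of_eq ?_
      simp only [φ]; ring

/-! ### From the weak-type bound to indicators, and from indicators to (A). -/

theorem measure_rpow_le_fracSeminorm_indicator {n : ℕ} (hn : 1 ≤ n) {δ : ℝ} (hδ0 : 0 < δ)
    (hδ1 : δ < 1) {r : ℝ} (hr : 0 ≤ r) {c : ℝ≥0∞} (hc : c ≠ ⊤)
    {G : Set (EuclideanSpace ℝ (Fin n))} (hG : IsOpen G)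
    (h : ∀ f : EuclideanSpace ℝ (Fin n) → ℝ, ContDiff ℝ ∞ f → HasCompactSupport f →
      tsupport f ⊆ G → (∀ x, 0 ≤ f x) → ∀ s : ℝ, 0 < s →
      ENNReal.ofReal s * volume {x | s ≤ f x} ^ r ≤ c * fracSeminorm δ G f)
    {E K : Set (EuclideanSpace ℝ (Fin n))} (hE : MeasurableSet E) (hK : IsCompact K)
    (hEK : E ⊆ K) (hKG : K ⊆ G) :
    volume E ^ r ≤ c * fracSeminorm δ G (E.indicator 1) := by
  obtain ⟨f, hf, hfc, hfG, hf0, hfE, hlim⟩ := exists_smooth_approx_indicator δ hE hK hEK hG hKG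
  set g : EuclideanSpace ℝ (Fin n) → ℝ := E.indicator 1 with hg
  have hgm : Measurable g := measurable_one.indicator hE
  set w : EuclideanSpace ℝ (Fin n) → ℝ≥0∞ :=
    fun x => ∫⁻ y in Gᶜ, 1 / edist x y ^ ((n : ℝ) + δ) with hw
  have hwm : Measurable w := (measurable_inv_edist_rpow ((n : ℝ) + δ)).lintegral_prod_right'
  -- The contraction under mollification, with both whole-space seminorms split into a part over G
  -- and an interaction with its complement.
  have hdec : ∀ k, fracSeminorm δ G (f k) + 2 * ∫⁻ x in G, ‖f k x‖ₑ * w x ≤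
      fracSeminorm δ G g + 2 * ∫⁻ x in G, ‖g x‖ₑ * w x := by
    intro k
    rw [← fracSeminorm_univ_eq_add δ hG.measurableSet (hf k).continuous.measurable,
      ← fracSeminorm_univ_eq_add δ hG.measurableSet hgm]
    · exact hfE k
    · exact fun x hx => indicator_of_notMem (fun h => hx (hKG (hEK h))) _
    · exact fun x hx => image_eq_zero_of_notMem_tsupport fun h => hx (hfG k h)
  have hfin : 2 * ∫⁻ x in G, ‖g x‖ₑ * w x ≠ ⊤ := by
    refine ENNReal.mul_ne_top ENNReal.ofNat_ne_top (lt_of_le_of_lt ?_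
      (lintegral_kernel_compl_lt_top hn hδ0 hδ1 hK hG hKG)).ne
    rw [← lintegral_indicator hK.measurableSet]
    refine (setLIntegral_le_lintegral _ _).trans (lintegral_mono fun x => ?_)
    by_cases hx : x ∈ E
    · simp [hg, hx, hEK hx, hw]
    · simp [hg, hx]
  have hb : 2 * ∫⁻ x in G, ‖g x‖ₑ * w x ≤
      liminf (fun k => 2 * ∫⁻ x in G, ‖f k x‖ₑ * w x) atTop := by
    have hfm : ∀ k, Measurable fun x => 2 * (‖f k x‖ₑ * w x) := fun k =>
      ((hf k).continuous.measurable.enorm.mul hwm).const_mul 2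
    have h2 : ∀ u : EuclideanSpace ℝ (Fin n) → ℝ, Measurable u →
        2 * ∫⁻ x in G, ‖u x‖ₑ * w x = ∫⁻ x in G, 2 * (‖u x‖ₑ * w x) := fun u hu =>
      (lintegral_const_mul _ (hu.enorm.mul hwm)).symm
    rw [h2 g hgm]
    simp_rw [fun k => h2 (f k) (hf k).continuous.measurable]
    refine le_trans (lintegral_mono_ae ?_) (lintegral_liminf_le hfm)
    filter_upwards [ae_restrict_of_ae hlim] with x hx
    by_cases hxE : x ∈ E
    · have hw' : Tendsto (fun k => 2 * (‖f k x‖ₑ * w x)) atTop (𝓝 (2 * (‖g x‖ₑ * w x))) := by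
        refine ENNReal.Tendsto.const_mul (ENNReal.Tendsto.mul_const hx.enorm (Or.inl ?_))
          (Or.inr ENNReal.ofNat_ne_top)
        simp [hg, hxE]
      exact hw'.liminf_eq.ge
    · simp [hg, hxE]
  -- Fatou makes the limiting interaction term at most the liminf of the approximating ones; being
  -- finite, it cancels from `hdec`.
  have ha : liminf (fun k => fracSeminorm δ G (f k)) atTop ≤ fracSeminorm δ G g := by
    refine (ENNReal.add_le_add_iff_right hfin).1 ?_
    refine (add_le_add le_rfl hb).trans (ENNReal.liminf_add_liminf_le.trans ?_)
    exact liminf_le_of_le (by isBoundedDefault) fun b hb => by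
      obtain ⟨k, hk⟩ := hb.exists
      exact hk.trans (hdec k)
  have hs : ∀ s : ℝ, 0 < s → s < 1 → ENNReal.ofReal s * volume E ^ r ≤ c * fracSeminorm δ G g := by
    intro s hs0 hs1
    -- At almost every point of E the mollifications tend to 1 > s, so the point eventually lies in
    -- {s ≤ f k}; then Fatou applies.
    have hE' : volume E ≤ liminf (fun k => volume {x | s ≤ f k x}) atTop := by
      rw [← lintegral_indicator_one hE]
      have hms : ∀ k, MeasurableSet {x | s ≤ f k x} := fun k =>
        measurableSet_le measurable_const (hf k).continuous.measurable
      simp_rw [← fun k => lintegral_indicator_one (μ := volume) (hms k)]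
      refine le_trans (lintegral_mono_ae ?_)
        (lintegral_liminf_le fun k => measurable_one.indicator (hms k))
      filter_upwards [hlim] with x hx
      by_cases hxE : x ∈ E
      · rw [hg, indicator_of_mem hxE] at hx
        rw [indicator_of_mem hxE]
        refine le_liminf_of_le (by isBoundedDefault) ?_
        filter_upwards [hx.eventually (eventually_gt_nhds hs1)] with k hk
        rw [indicator_of_mem (show x ∈ {x | s ≤ f k x} from le_of_lt hk)]
      · simp [hxE]
    have hmono : Monotone fun v : ℝ≥0∞ => ENNReal.ofReal s * v ^ r := fun a b hab =>
      mul_le_mul_right (ENNReal.rpow_le_rpow hab hr) _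
    have hcont : Continuous fun v : ℝ≥0∞ => ENNReal.ofReal s * v ^ r :=
      (ENNReal.continuous_const_mul ENNReal.ofReal_ne_top).comp ENNReal.continuous_rpow_const
    have hcmono : Monotone fun v : ℝ≥0∞ => c * v := fun a b hab => mul_le_mul_right hab _
    calc ENNReal.ofReal s * volume E ^ r
        ≤ ENNReal.ofReal s * liminf (fun k => volume {x | s ≤ f k x}) atTop ^ r := hmono hE'
      _ = liminf (fun k => ENNReal.ofReal s * volume {x | s ≤ f k x} ^ r) atTop :=
        hmono.map_liminf_of_continuousAt _ hcont.continuousAt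
      _ ≤ liminf (fun k => c * fracSeminorm δ G (f k)) atTop :=
        liminf_le_liminf (Eventually.of_forall fun k =>
          h (f k) (hf k) (hfc k) (hfG k) (hf0 k) s hs0)
      _ = c * liminf (fun k => fracSeminorm δ G (f k)) atTop :=
        (hcmono.map_liminf_of_continuousAt _
          (ENNReal.continuous_const_mul hc).continuousAt).symm
      _ ≤ _ := hcmono ha
  have hlim1 : Tendsto (fun s : ℝ => ENNReal.ofReal s * volume E ^ r) (𝓝[<] 1)
      (𝓝 (ENNReal.ofReal 1 * volume E ^ r)) := by
    refine ENNReal.Tendsto.mul_const ?_ (Or.inl (by simp))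
    exact (ENNReal.continuous_ofReal.tendsto 1).mono_left nhdsWithin_le_nhds
  rw [ENNReal.ofReal_one, one_mul] at hlim1
  refine le_of_tendsto hlim1 ?_
  filter_upwards [Ioo_mem_nhdsLT (zero_lt_one (α := ℝ))] with s hs'
  exact hs s hs'.1 hs'.2

theorem fracSeminorm_congr_ae {n : ℕ} (δ : ℝ) (G : Set (EuclideanSpace ℝ (Fin n)))
    {u v : EuclideanSpace ℝ (Fin n) → ℝ} (h : u =ᵐ[volume] v) :
    fracSeminorm δ G u = fracSeminorm δ G v := by
  refine lintegral_congr_ae ?_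
  filter_upwards [ae_restrict_of_ae h] with x hx
  refine lintegral_congr_ae ?_
  filter_upwards [ae_restrict_of_ae h] with y hy
  rw [hx, hy]

/-- Apply the hypothesis to each set {|u| > t} with t > 0 and integrate in t: Minkowski bounds the
left side from above, and the coarea formula evaluates the right side as the seminorm of |u|, which
is at most that of u. -/
theorem lintegral_rpow_le_fracSeminorm_of_indicator {n : ℕ} {δ q : ℝ} (hq : 1 < q) {c : ℝ≥0∞}
    (hc : c ≠ ⊤) {G : Set (EuclideanSpace ℝ (Fin n))}
    (h : ∀ E K : Set (EuclideanSpace ℝ (Fin n)), MeasurableSet E → IsCompact K → E ⊆ K → K ⊆ G →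
      volume E ^ (1 / q) ≤ c * fracSeminorm δ G (E.indicator 1))
    {u : EuclideanSpace ℝ (Fin n) → ℝ} (hu : AEMeasurable u volume) (huc : HasCompactSupport u)
    (huG : tsupport u ⊆ G) :
    (∫⁻ x in G, ‖u x‖ₑ ^ q) ^ (1 / q) ≤ c * fracSeminorm δ G u := by
  have hq0 : 0 < q := by linarith
  set K := tsupport u with hK
  -- A Borel representative, cut off so that all its superlevel sets at positive heights stay inside
  -- K.
  set v : EuclideanSpace ℝ (Fin n) → ℝ := K.indicator (hu.mk u) with hv
  have hKm : MeasurableSet K := (isClosed_tsupport u).measurableSet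
  have hvm : Measurable v := hu.measurable_mk.indicator hKm
  have huv : u =ᵐ[volume] v := by
    filter_upwards [hu.ae_eq_mk] with x hx
    by_cases hxK : x ∈ K
    · simp [hv, hxK, hx]
    · simp [hv, hxK, image_eq_zero_of_notMem_tsupport hxK]
  have hv0 : ∀ x ∉ K, v x = 0 := fun x hx => indicator_of_notMem hx _
  have habs : fracSeminorm δ G (fun x => |v x|) ≤ fracSeminorm δ G v := by
    refine lintegral_mono fun x => lintegral_mono fun y => ENNReal.div_le_div_right ?_ _
    rw [enorm_le_iff_norm_le, Real.norm_eq_abs, Real.norm_eq_abs]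
    exact abs_abs_sub_abs_le _ _
  have hint : ∫⁻ x in G, ‖u x‖ₑ ^ q = ∫⁻ x in K, ‖v x‖ₑ ^ q := by
    rw [lintegral_congr_ae (g := fun x => ‖v x‖ₑ ^ q)
      (by filter_upwards [ae_restrict_of_ae huv] with x hx; rw [hx]),
      ← lintegral_inter_add_sdiff _ G hKm, inter_eq_right.2 huG]
    have hz : ∫⁻ x in G \ K, ‖v x‖ₑ ^ q ≤ ∫⁻ x in Kᶜ, ‖v x‖ₑ ^ q :=
      lintegral_mono_set fun x hx => hx.2
    rw [setLIntegral_congr_fun (g := fun _ => 0) hKm.compl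
      (fun x hx => by simp [hv0 x hx, hq0]), lintegral_zero] at hz
    rw [nonpos_iff_eq_zero.1 hz, add_zero]
  have : IsFiniteMeasure (volume.restrict K) :=
    ⟨by rw [Measure.restrict_apply_univ]; exact IsCompact.measure_lt_top huc⟩
  rw [fracSeminorm_congr_ae δ G huv, hint]
  refine (lintegral_rpow_le_lintegral_measure_rpow (volume.restrict K) hq hvm.enorm
    fun x => enorm_ne_top).trans ?_
  refine le_trans ?_ (mul_le_mul_right habs c)
  rw [fracSeminorm_eq_lintegral_superlevel δ G (by fun_prop : Measurable fun x => |v x|),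
    ← lintegral_const_mul' _ _ hc]
  refine le_trans ?_ (setLIntegral_le_lintegral (Ioi 0) _)
  refine setLIntegral_mono' measurableSet_Ioi fun t ht => ?_
  have hset : {x | ENNReal.ofReal t < ‖v x‖ₑ} = {x | t < |v x|} := by
    ext x
    rw [mem_ofPred_eq, mem_ofPred_eq, Real.enorm_eq_ofReal_abs,
      ENNReal.ofReal_lt_ofReal_iff_of_nonneg (le_of_lt ht)]
  rw [hset]
  refine (ENNReal.rpow_le_rpow (Measure.restrict_le_self _) (by positivity)).trans
    (h _ K (measurableSet_lt measurable_const (by fun_prop)) huc (fun x hx => ?_) huG)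
  by_contra hxK
  have : t < |v x| := hx
  rw [hv0 x hxK, abs_zero] at this
  exact absurd this (not_lt.2 (le_of_lt ht))

/-! ### Regular level sets are smooth hypersurfaces. -/

/-- This turns the vertical axis into a direction transversal to a level set. If L e = 0, some unit
vector w orthogonal to e has L w ≠ 0, and a rotation taking e to w suffices. -/
theorem exists_rotation_apply_ne_zero {n : ℕ} (e : EuclideanSpace ℝ (Fin n))
    (he : ‖e‖ = 1) {L : EuclideanSpace ℝ (Fin n) →L[ℝ] ℝ} (hL : L ≠ 0) :
    ∃ R : EuclideanSpace ℝ (Fin n) ≃ₗᵢ[ℝ] EuclideanSpace ℝ (Fin n),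
      LinearMap.det (R.toLinearEquiv :
        EuclideanSpace ℝ (Fin n) →ₗ[ℝ] EuclideanSpace ℝ (Fin n)) = 1 ∧ L (R e) ≠ 0 := by
  by_cases h : L e ≠ 0
  · exact ⟨LinearIsometryEquiv.refl ℝ _, by simp, by simpa using h⟩
  push Not at h
  obtain ⟨v, hv⟩ : ∃ v, L v ≠ 0 := by
    by_contra! h'
    exact hL (ContinuousLinearMap.ext h')

  set v' := v - (inner ℝ e v) • e with hv'
  have hLv' : L v' ≠ 0 := by simpa [hv', h] using hv
  have hv'0 : v' ≠ 0 := fun h0 => hLv' (by rw [h0, map_zero])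
  have hev' : inner ℝ e v' = 0 := by
    simp [hv', inner_sub_right, inner_smul_right, he]
  set w := ‖v'‖⁻¹ • v' with hw
  have hw1 : ‖w‖ = 1 := norm_smul_inv_norm hv'0
  have hLw : L w ≠ 0 := by simp [hw, hLv', hv'0]
  have hew : inner ℝ e w = 0 := by simp [hw, inner_smul_right, hev']
  have hdet : ∀ z : EuclideanSpace ℝ (Fin n), z ≠ 0 →
      LinearMap.det ((ℝ ∙ z)ᗮ.reflection.toLinearMap) = -1 := by
    intro z hz
    rw [Submodule.det_reflection, Submodule.orthogonal_orthogonal, finrank_span_singleton hz, pow_one]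
  have hew0 : e - w ≠ 0 := by
    intro h0
    rw [sub_eq_zero] at h0
    rw [← h0, real_inner_self_eq_norm_sq, he] at hew
    norm_num at hew
  -- The first reflection fixes e and the second carries e to w; a product of two reflections has
  -- determinant 1.
  refine ⟨(ℝ ∙ w)ᗮ.reflection.trans (ℝ ∙ (e - w))ᗮ.reflection, ?_, ?_⟩
  · change LinearMap.det ((ℝ ∙ (e - w))ᗮ.reflection.toLinearMap ∘ₗ
      (ℝ ∙ w)ᗮ.reflection.toLinearMap) = 1
    rw [LinearMap.det_comp, hdet _ hew0, hdet w (norm_ne_zero_iff.1 (by rw [hw1]; exact one_ne_zero))]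
    norm_num
  · have h1 : (ℝ ∙ w)ᗮ.reflection e = e := by
      rw [Submodule.reflection_eq_self_iff, Submodule.mem_orthogonal_singleton_iff_inner_right,
        real_inner_comm, hew]
    rw [LinearIsometryEquiv.trans_apply, h1, Submodule.reflection_sub (by rw [he, hw1])]
    exact hLw

/-- Local form of the implicit function theorem: the zero set is a smooth graph over a product
neighbourhood. -/
theorem exists_graph_nhds {E : Type*} [NormedAddCommGroup E] [NormedSpace ℝ E] [CompleteSpace E]
    {F : E × ℝ → ℝ} (hF : ContDiff ℝ ∞ F) {N : Set (E × ℝ)} {z₀ : E × ℝ} (hN : N ∈ 𝓝 z₀)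
    (h0 : F z₀ = 0) (h' : fderiv ℝ F z₀ (0, 1) ≠ 0) :
    ∃ (U : Set E) (V : Set ℝ) (g : E → ℝ), IsOpen U ∧ IsOpen V ∧ ContDiffOn ℝ ∞ g U ∧
      MapsTo g U V ∧ z₀.1 ∈ U ∧ z₀.2 ∈ V ∧ U ×ˢ V ⊆ N ∧
      ∀ y ∈ U, ∀ s ∈ V, F (y, s) = 0 ↔ s = g y := by

  -- The inverse function theorem is applied to (y, s) ↦ (y, F(y, s)); the graph function g(y) is
  -- the second coordinate of the preimage of (y, 0).
  set Φ : E × ℝ → E × ℝ := fun z => (z.1, F z) with hΦ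
  have hΦd : ContDiff ℝ ∞ Φ := contDiff_fst.prodMk hF
  have hequiv : ∀ z, fderiv ℝ F z (0, 1) ≠ 0 → ∃ A : (E × ℝ) ≃L[ℝ] (E × ℝ),
      HasFDerivAt Φ (A : E × ℝ →L[ℝ] E × ℝ) z := by
    intro z hz
    set a := fderiv ℝ F z (0, 1)
    set B : E →L[ℝ] ℝ := (fderiv ℝ F z).comp (ContinuousLinearMap.inl ℝ E ℝ)
    have hFz : ∀ p : E × ℝ, fderiv ℝ F z p = B p.1 + p.2 * a := by
      intro p
      have : p = (p.1, 0) + p.2 • ((0 : E), (1 : ℝ)) := by ext <;> simp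
      conv_lhs => rw [this]
      rw [map_add, map_smul]
      rfl
    refine ⟨ContinuousLinearEquiv.equivOfInverse
      ((ContinuousLinearMap.fst ℝ E ℝ).prod (fderiv ℝ F z))
      ((ContinuousLinearMap.fst ℝ E ℝ).prod
        (a⁻¹ • (ContinuousLinearMap.snd ℝ E ℝ - B.comp (ContinuousLinearMap.fst ℝ E ℝ))))
      ?_ ?_, ?_⟩
    · intro p
      ext
      · simp
      · simp [hFz]
        field_simp
    · intro p
      ext
      · simp
      · simp [hFz]
        field_simp
        ring
    · exact hasFDerivAt_fst.prodMk (hF.differentiable (by simp)).differentiableAt.hasFDerivAt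
  obtain ⟨A, hA⟩ := hequiv z₀ h'
  set e := hΦd.contDiffAt.toOpenPartialHomeomorph Φ hA (by simp) with he
  have heΦ : ∀ z, e z = Φ z := fun z => rfl
  have hz₀ : z₀ ∈ e.source := hΦd.contDiffAt.mem_toOpenPartialHomeomorph_source hA (by simp)
  have hopen : IsOpen {z | fderiv ℝ F z (0, 1) ≠ 0} := by
    have hc : Continuous fun z => fderiv ℝ F z (0, 1) :=
      (hF.continuous_fderiv (by simp)).clm_apply continuous_const
    exact isOpen_ne_fun hc continuous_const
  have hS : e.source ∩ ({z | fderiv ℝ F z (0, 1) ≠ 0} ∩ N) ∈ 𝓝 z₀ :=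
    inter_mem (e.open_source.mem_nhds hz₀) (inter_mem (hopen.mem_nhds h') hN)
  obtain ⟨U₀, V, hU₀, hzU, hV, hzV, hUV⟩ := mem_nhds_prod_iff'.1 hS
  have hi : Continuous fun y : E => (y, (0 : ℝ)) := by fun_prop
  -- Requiring the preimage of (y, 0) to lie in U₀ × V forces g(y) ∈ V and keeps the vertical
  -- derivative of F nonzero there, so g is smooth on all of U. Uniqueness of the zero in V is
  -- injectivity on U₀ × V.
  set U : Set E := U₀ ∩ (fun y : E => (y, (0 : ℝ))) ⁻¹' (e.target ∩ e.symm ⁻¹' (U₀ ×ˢ V)) with hU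
  have hUo : IsOpen U :=
    hU₀.inter ((e.isOpen_inter_preimage_symm (hU₀.prod hV)).preimage hi)
  have hsymm : ∀ y ∈ U, (e.symm (y, 0)).1 = y ∧ F (e.symm (y, 0)) = 0 := by
    intro y hy
    have := e.right_inv hy.2.1
    rw [heΦ] at this
    exact ⟨congrArg Prod.fst this, congrArg Prod.snd this⟩
  have hΦ0 : Φ z₀ = (z₀.1, 0) := by simp [hΦ, h0]
  have hz₀e : e.symm (z₀.1, 0) = z₀ := by
    have := e.left_inv hz₀
    rwa [heΦ, hΦ0] at this
  refine ⟨U, V, fun y => (e.symm (y, 0)).2, hUo, hV, ?_, ?_, ?_, hzV, ?_, ?_⟩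
  · intro y hy
    have hmem := hUV hy.2.2
    obtain ⟨A', hA'⟩ := hequiv _ hmem.2.1
    have hs : ContDiffAt ℝ ∞ e.symm (y, 0) :=
      e.contDiffAt_symm hy.2.1 hA' hΦd.contDiffAt
    have : ContDiffAt ℝ ∞ (fun y => (e.symm (y, 0)).2) y :=
      contDiffAt_snd.comp y (hs.comp y (contDiffAt_id.prodMk contDiffAt_const))
    exact this.contDiffWithinAt
  · exact fun y hy => hy.2.2.2
  · refine ⟨hzU, ?_, ?_⟩
    · have := e.map_source hz₀
      rwa [heΦ, hΦ0] at this
    · show e.symm (z₀.1, 0) ∈ U₀ ×ˢ V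
      rw [hz₀e]; exact ⟨hzU, hzV⟩
  · rintro ⟨y, s⟩ ⟨hy, hs⟩
    exact (hUV ⟨hy.1, hs⟩).2.2
  · intro y hy s hs
    constructor
    · intro hF0
      have hmem : (y, s) ∈ e.source := (hUV ⟨hy.1, hs⟩).1
      have := e.left_inv hmem
      rw [heΦ, hΦ] at this
      simp only [hF0] at this
      simp [this]
    · rintro rfl
      have h1 := hsymm y hy
      have : (y, (e.symm (y, 0)).2) = e.symm (y, 0) := Prod.ext h1.1.symm rfl
      rw [this, h1.2]

/-- `joinLast` as a linear isomorphism `ℝⁿ⁻¹ × ℝ ≃ ℝⁿ`. -/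
noncomputable def joinLastEquiv {n : ℕ} (hn : 1 ≤ n) :
    (EuclideanSpace ℝ (Fin (n - 1)) × ℝ) ≃L[ℝ] EuclideanSpace ℝ (Fin n) :=
  LinearEquiv.toContinuousLinearEquiv
    { toFun := fun z => joinLast z.1 z.2
      map_add' := fun z w => by
        ext i
        by_cases h : i.val < n - 1 <;> simp [joinLast, h]
      map_smul' := fun c z => by
        ext i
        by_cases h : i.val < n - 1 <;> simp [joinLast, h]
      invFun := fun x => (WithLp.toLp 2 fun i => x ⟨i.val, by omega⟩, x ⟨n - 1, by omega⟩)
      left_inv := fun z => by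
        refine Prod.ext ?_ ?_
        · ext i; simp [joinLast]
        · simp [joinLast]
      right_inv := fun x => by
        ext i
        by_cases h : i.val < n - 1
        · simp [joinLast, h]
        · have hlt : n - 1 < n := by omega
          have : i = ⟨n - 1, hlt⟩ := by ext; simp; omega
          subst this
          simp [joinLast] }

theorem norm_joinLast_zero_one {n : ℕ} (hn : 1 ≤ n) :
    ‖(joinLast 0 1 : EuclideanSpace ℝ (Fin n))‖ = 1 := by
  have : (joinLast 0 1 : EuclideanSpace ℝ (Fin n)) = EuclideanSpace.single ⟨n - 1, by omega⟩ 1 := by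
    ext i
    by_cases h : i.val < n - 1
    · have : i ≠ ⟨n - 1, by omega⟩ := fun h' => by rw [h'] at h; simp at h
      simp [joinLast, h, this]
    · have hlt : n - 1 < n := by omega
      have : i = ⟨n - 1, hlt⟩ := by ext; simp; omega
      subst this
      simp [joinLast]
  rw [this]; simp

/-- A point of {h = t} outside the closure of {h > t} would be a local maximum, hence critical. -/
theorem frontier_superlevel_eq {E : Type*} [NormedAddCommGroup E] [NormedSpace ℝ E] {h : E → ℝ}
    (hc : Continuous h) {t : ℝ} (hreg : ∀ x, h x = t → fderiv ℝ h x ≠ 0) :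
    frontier {x | t < h x} = {x | h x = t} := by
  refine Subset.antisymm ?_ fun x hx => ?_
  · exact fun x hx => (frontier_lt_subset_eq continuous_const hc hx).symm
  · rw [(isOpen_lt continuous_const hc).frontier_eq]
    refine ⟨?_, fun h' => ne_of_gt (show t < h x from h') hx⟩
    by_contra hcl
    refine hreg x hx (IsLocalMax.fderiv_eq_zero ?_)
    filter_upwards [isClosed_closure.isOpen_compl.mem_nhds hcl] with y hy
    have : ¬ t < h y := fun h' => hy (subset_closure h')
    rw [show h x = t from hx]
    exact not_lt.1 this

/-- After a rotation about x that makes the vertical derivative nonzero at x, the implicit function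
theorem describes the level set as a graph. -/
theorem isSmoothHypersurfaceIn_frontier_superlevel {n : ℕ} (hn : 1 ≤ n)
    {G : Set (EuclideanSpace ℝ (Fin n))} {h : EuclideanSpace ℝ (Fin n) → ℝ}
    (hh : ContDiff ℝ ∞ h) {t : ℝ} (hreg : ∀ x, h x = t → fderiv ℝ h x ≠ 0)
    (hG : closure {x | t < h x} ⊆ G) :
    IsSmoothHypersurfaceIn (frontier {x | t < h x}) G := by
  refine ⟨frontier_subset_closure.trans hG, isClosed_frontier.preimage continuous_subtype_val,
    fun x hx => ?_⟩
  rw [frontier_superlevel_eq hh.continuous hreg] at hx ⊢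
  have hxt : h x = t := hx
  obtain ⟨R, hR, hRL⟩ := exists_rotation_apply_ne_zero (joinLast 0 1)
    (norm_joinLast_zero_one hn) (hreg x hxt)
  set J := joinLastEquiv hn with hJ
  set ψ : EuclideanSpace ℝ (Fin n) → EuclideanSpace ℝ (Fin n) := fun z => x + R (z - x) with hψ
  set F : EuclideanSpace ℝ (Fin (n - 1)) × ℝ → ℝ := fun z => h (ψ (J z)) - t with hFdef
  have hψx : ψ x = x := by simp [hψ]
  have hψd : ContDiff ℝ ∞ ψ :=
    contDiff_const.add (R.toContinuousLinearEquiv.contDiff.comp (contDiff_id.sub contDiff_const))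
  have hF : ContDiff ℝ ∞ F := (hh.comp (hψd.comp J.contDiff)).sub contDiff_const
  have hz : ψ (J (J.symm x)) = x := by rw [J.apply_symm_apply, hψx]
  have hF0 : F (J.symm x) = 0 := by rw [hFdef]; simp only [hz, hxt, sub_self]
  have hF' : fderiv ℝ F (J.symm x) (0, 1) ≠ 0 := by
    have hd1 : HasFDerivAt (fun z => ψ (J z))
        ((R.toContinuousLinearEquiv : EuclideanSpace ℝ (Fin n) →L[ℝ] EuclideanSpace ℝ (Fin n)).comp
          (J : EuclideanSpace ℝ (Fin (n - 1)) × ℝ →L[ℝ] EuclideanSpace ℝ (Fin n))) (J.symm x) :=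
      ((R.toContinuousLinearEquiv.hasFDerivAt).comp _
        (J.hasFDerivAt.sub_const x)).const_add x
    have hd2 : HasFDerivAt h (fderiv ℝ h x) (ψ (J (J.symm x))) := by
      rw [hz]; exact (hh.differentiable (by simp)).differentiableAt.hasFDerivAt
    have hd3 := (HasFDerivAt.comp (f := fun z => ψ (J z)) _ hd2 hd1).sub_const t
    rw [show F = fun z => (h ∘ fun z => ψ (J z)) z - t from rfl, hd3.fderiv]
    exact hRL
  obtain ⟨U, V, g, hU, hV, hg, hgUV, hzU, hzV, -, hiff⟩ :=
    exists_graph_nhds hF univ_mem hF0 hF'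
  refine ⟨U, V, g, R, ψ, hU, hV, hg, hgUV, hR, fun z => rfl,
    ⟨J (J.symm x), ⟨_, hzU, _, hzV, rfl⟩, hz⟩, ?_⟩
  have hlevel : ∀ y s, h (ψ (joinLast y s)) = t ↔ F (y, s) = 0 := fun y s => by
    rw [hFdef]; exact sub_eq_zero.symm
  ext p
  constructor
  · rintro ⟨hp, _, ⟨y, hy, s, hs, rfl⟩, rfl⟩
    rw [mem_ofPred_eq, hlevel, hiff y hy s hs] at hp
    exact ⟨y, hy, by rw [hp]⟩
  · rintro ⟨y, hy, rfl⟩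
    refine ⟨?_, _, ⟨y, hy, g y, hgUV hy, rfl⟩, rfl⟩
    rw [mem_ofPred_eq, hlevel, hiff y hy _ (hgUV hy)]

/-! ### Generic tilting, and (C) implies the weak-type bound. -/

/-- A small linear perturbation of a smooth function has only countably many critical points. -/
theorem exists_countable_critical_add_inner {E : Type*} [NormedAddCommGroup E]
    [InnerProductSpace ℝ E] [FiniteDimensional ℝ E] {f : E → ℝ} (hf : ContDiff ℝ 2 f) {ε : ℝ}
    (hε : 0 < ε) :
    ∃ a : E, ‖a‖ < ε ∧ {x | fderiv ℝ f x + innerSL ℝ a = 0}.Countable := by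
  borelize E
  let T := (InnerProductSpace.toDual ℝ E).symm
  set g : E → E := fun x => T (fderiv ℝ f x) with hg
  have hgd : ContDiff ℝ 1 g :=
    T.toContinuousLinearEquiv.contDiff.comp (hf.fderiv_right (by norm_num))
  have hgf : ∀ x, HasFDerivAt g (fderiv ℝ g x) x := fun x =>
    ((hgd.differentiable one_ne_zero) x).hasFDerivAt
  -- Equidimensional Sard for the gradient g: its critical values form a null set, so a regular
  -- value b exists arbitrarily near 0. Tilting f by -b makes the critical set equal to the fibre of
  -- g over b.
  set S : Set E := {x | (fderiv ℝ g x).det = 0} with hS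
  have hS0 : (volume : Measure E) (g '' S) = 0 :=
    addHaar_image_eq_zero_of_det_fderivWithin_eq_zero volume
      (fun x _ => (hgf x).hasFDerivWithinAt) fun x hx => hx
  obtain ⟨b, hb, hbS⟩ : ∃ b ∈ Metric.ball (0 : E) ε, b ∉ g '' S := by
    by_contra! h
    exact absurd (measure_mono_null h hS0) (Metric.measure_ball_pos volume 0 hε).ne'
  refine ⟨-b, by simpa using hb, ?_⟩
  have hZ : {x | fderiv ℝ f x + innerSL ℝ (-b) = 0} = {x | g x = b} := by
    ext x
    rw [mem_ofPred_eq, mem_ofPred_eq, map_neg, ← sub_eq_add_neg, sub_eq_zero, hg,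
      LinearIsometryEquiv.symm_apply_eq]
    rfl
  rw [hZ]
  -- At points of the fibre the derivative of g is invertible, so they are isolated; a discrete
  -- subset of E is countable.
  have hdisc : IsDiscrete {x | g x = b} := by
    rw [isDiscrete_iff_discreteTopology, discreteTopology_subtype_iff]
    intro x hx
    have hdet : (fderiv ℝ g x).det ≠ 0 := fun h => hbS ⟨x, h, hx⟩
    have hne : ∀ᶠ z in 𝓝[≠] x, g z ≠ b := by
      have hA : HasFDerivAt g ((fderiv ℝ g x).toContinuousLinearEquivOfDetNeZero hdet : E →L[ℝ] E)
        x := hgf x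
      exact hA.eventually_ne ⟨_, ContinuousLinearEquiv.antilipschitz _⟩
    rw [← disjoint_iff, disjoint_principal_right]
    exact hne
  exact (HereditarilyLindelofSpace.isLindelof _).countable_of_isDiscrete hdisc

theorem fracSeminorm_add_le {n : ℕ} (δ : ℝ) (G : Set (EuclideanSpace ℝ (Fin n)))
    {u v : EuclideanSpace ℝ (Fin n) → ℝ} (hu : Measurable u) :
    fracSeminorm δ G (fun x => u x + v x) ≤ fracSeminorm δ G u + fracSeminorm δ G v := by
  have hm := measurable_fracSeminorm_integrand ((n : ℝ) + δ) hu
  have hmx : ∀ x, Measurable fun y => ‖u x - u y‖ₑ / edist x y ^ ((n : ℝ) + δ) := fun x =>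
    hm.comp measurable_prodMk_left
  have hmX : Measurable fun x => ∫⁻ y in G, ‖u x - u y‖ₑ / edist x y ^ ((n : ℝ) + δ) :=
    hm.lintegral_prod_right'
  unfold fracSeminorm
  rw [← lintegral_add_left hmX]
  refine lintegral_mono fun x => ?_
  rw [← lintegral_add_left (hmx x)]
  refine lintegral_mono fun y => ?_
  rw [← ENNReal.add_div, show u x + v x - (u y + v y) = (u x - u y) + (v x - v y) by ring]
  exact ENNReal.div_le_div_right (enorm_add_le _ _) _

theorem exists_contDiff_one_nhdsSet {n : ℕ} {K : Set (EuclideanSpace ℝ (Fin n))}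
    (hK : IsCompact K) :
    ∃ χ : EuclideanSpace ℝ (Fin n) → ℝ, ContDiff ℝ ∞ χ ∧ HasCompactSupport χ ∧
      ∀ᶠ x in 𝓝ˢ K, χ x = 1 := by
  obtain ⟨χ, h1, h0, -⟩ := exists_contMDiffMap_one_nhds_of_subset_interior (n := ⊤)
    (modelWithCornersSelf ℝ (EuclideanSpace ℝ (Fin n))) (s := K) (t := Metric.cthickening 1 K)
    hK.isClosed ((Metric.self_subset_thickening one_pos K).trans
      (interior_maximal (Metric.thickening_subset_cthickening 1 K) Metric.isOpen_thickening))
  exact ⟨χ, χ.contMDiff.contDiff, HasCompactSupport.intro hK.cthickening h0, h1⟩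

/-- The seminorm of a compactly supported smooth truncation of a linear functional is controlled
by the norm of the functional. -/
theorem exists_fracSeminorm_inner_le {n : ℕ} (hn : 1 ≤ n) {δ : ℝ} (hδ0 : 0 < δ) (hδ1 : δ < 1)
    (G : Set (EuclideanSpace ℝ (Fin n))) {w : EuclideanSpace ℝ (Fin n) → EuclideanSpace ℝ (Fin n)}
    (hw : ContDiff ℝ ∞ w) (hwc : HasCompactSupport w) :
    ∃ M : ℝ≥0∞, M ≠ ⊤ ∧ ∀ a, fracSeminorm δ G (fun x => inner ℝ a (w x)) ≤ ‖a‖ₑ * M := by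
  obtain ⟨L, hL⟩ := ContDiff.lipschitzWith_of_hasCompactSupport hwc hw (by simp)
  obtain ⟨B₀, hB₀⟩ := hwc.exists_bound_of_continuous hw.continuous
  set B := tsupport w with hB
  -- The Lipschitz constant serves distances at most 1, and twice the sup bound serves larger ones.
  set c : ℝ≥0∞ := max L (ENNReal.ofReal (2 * B₀)) with hc
  have hle : ∀ x y, ‖w x - w y‖ₑ ≤ c * ((B.indicator 1 x + B.indicator 1 y) * min (edist x y) 1) := by
    intro x y
    by_cases hxy : x ∈ B ∨ y ∈ B
    · have h1 : (1 : ℝ≥0∞) ≤ B.indicator 1 x + B.indicator 1 y := by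
        rcases hxy with h | h
        · rw [indicator_of_mem h]; exact le_self_add
        · rw [indicator_of_mem h]; exact le_add_self
      have h2 : ‖w x - w y‖ₑ ≤ c * min (edist x y) 1 := by
        rcases le_total (edist x y) 1 with h | h
        · rw [min_eq_left h, ← edist_eq_enorm_sub]
          exact (hL x y).trans (mul_le_mul_left (le_max_left _ _) _)
        · rw [min_eq_right h, mul_one, ← ofReal_norm]
          refine le_max_of_le_right (ENNReal.ofReal_le_ofReal ?_)
          linarith [norm_sub_le (w x) (w y), hB₀ x, hB₀ y]
      refine h2.trans (mul_le_mul_right ?_ c)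
      calc min (edist x y) 1 = 1 * min (edist x y) 1 := (one_mul _).symm
        _ ≤ _ := mul_le_mul_left h1 _
    · push Not at hxy
      rw [image_eq_zero_of_notMem_tsupport hxy.1, image_eq_zero_of_notMem_tsupport hxy.2]
      simp
  refine ⟨c * (2 * (volume B * kernelMass n δ)), ?_, fun a => ?_⟩
  · refine ENNReal.mul_ne_top (max_lt ENNReal.coe_lt_top ENNReal.ofReal_lt_top).ne (ENNReal.mul_ne_top ENNReal.ofNat_ne_top
      (ENNReal.mul_ne_top ?_ (kernelMass_lt_top hn hδ0 hδ1).ne))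
    exact (IsCompact.measure_lt_top hwc).ne
  · rw [← mul_assoc]
    refine fracSeminorm_le_of_enorm_sub_le δ G (isClosed_tsupport w).measurableSet _ fun x y => ?_
    rw [← inner_sub_right, mul_assoc]
    refine le_trans ?_ (mul_le_mul_right (hle x y) _)
    rw [← ofReal_norm, ← ofReal_norm, ← ofReal_norm,
      ← ENNReal.ofReal_mul (norm_nonneg _)]
    exact ENNReal.ofReal_le_ofReal (norm_inner_le_norm _ _)

/-- Integrate the hypothesis over almost every level of a perturbation u of f with countably many
critical points on the support of f, use the coarea formula, and let the perturbation tend to zero.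
-/
theorem measure_superlevel_rpow_le_of_isoperimetric {n : ℕ} (hn : 1 ≤ n) {δ : ℝ} (hδ0 : 0 < δ)
    (hδ1 : δ < 1) {r : ℝ} {c : ℝ≥0∞} (hr : 0 ≤ r) (hc : c ≠ ⊤)
    {G : Set (EuclideanSpace ℝ (Fin n))}
    (h : ∀ D : Set (EuclideanSpace ℝ (Fin n)), IsOpen D → IsCompact (closure D) → closure D ⊆ G →
      IsSmoothHypersurfaceIn (frontier D) G →
      volume D ^ r ≤ c * fracSeminorm δ G (D.indicator 1))
    {f : EuclideanSpace ℝ (Fin n) → ℝ} (hf : ContDiff ℝ ∞ f) (hfc : HasCompactSupport f)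
    (hfG : tsupport f ⊆ G) {s : ℝ} (hs : 0 < s) :
    ENNReal.ofReal s * volume {x | s ≤ f x} ^ r ≤ c * fracSeminorm δ G f := by
  obtain ⟨χ, hχ, hχc, hχ1⟩ := exists_contDiff_one_nhdsSet hfc
  -- Equal to the identity near the support of f, so pairing with a tilts f linearly there, yet
  -- compactly supported, so the tilt has finite seminorm.
  set w : EuclideanSpace ℝ (Fin n) → EuclideanSpace ℝ (Fin n) := fun x => χ x • x with hw
  have hwd : ContDiff ℝ ∞ w := hχ.smul contDiff_id
  have hwc : HasCompactSupport w := hχc.smul_right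
  obtain ⟨M, hM, hMle⟩ := exists_fracSeminorm_inner_le hn hδ0 hδ1 G hwd hwc
  obtain ⟨B, hB⟩ := hwc.exists_bound_of_continuous hwd.continuous
  have hB0 : 0 ≤ B := (norm_nonneg _).trans (hB 0)
  -- The perturbation is at most εB in size. Levels t > εB of u are reached only on the support of
  -- f, and for t < s - εB the set {u > t} contains {f ≥ s}; the interval between has length s -
  -- 2εB.
  have hε : ∀ ε : ℝ, 0 < ε → ENNReal.ofReal (s - 2 * (ε * B)) * volume {x | s ≤ f x} ^ r ≤
      c * (fracSeminorm δ G f + ENNReal.ofReal ε * M) := by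
    intro ε hε
    obtain ⟨a, haε, hZ⟩ := exists_countable_critical_add_inner (contDiff_infty.1 hf 2) hε
    set v : EuclideanSpace ℝ (Fin n) → ℝ := fun x => inner ℝ a (w x) with hv
    have hvd : ContDiff ℝ ∞ v := contDiff_const.inner ℝ hwd
    set u : EuclideanSpace ℝ (Fin n) → ℝ := fun x => f x + v x with hu
    have hud : ContDiff ℝ ∞ u := hf.add hvd
    have hvle : ∀ x, |v x| ≤ ε * B := fun x =>
      (abs_real_inner_le_norm _ _).trans (mul_le_mul haε.le (hB x) (norm_nonneg _) hε.le)
    set Z := {x | fderiv ℝ f x + innerSL ℝ a = 0} with hZdef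
    have hloc : ∀ x ∈ tsupport f, fderiv ℝ u x = fderiv ℝ f x + innerSL ℝ a := by
      intro x hx
      have h1 : v =ᶠ[𝓝 x] innerSL ℝ a := by
        filter_upwards [hχ1.filter_mono (nhds_le_nhdsSet hx)] with y hy
        simp [hv, hw, hy]
      rw [hu, fderiv_fun_add (hf.differentiable (by simp) x) (hvd.differentiable (by simp) x),
        h1.fderiv_eq, ContinuousLinearMap.fderiv]
    have hmem : ∀ t, ε * B < t → ∀ x, t ≤ u x → x ∈ tsupport f := by
      intro t ht x hx
      by_contra hxf
      have h0 := image_eq_zero_of_notMem_tsupport hxf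
      have h1 := (le_abs_self _).trans (hvle x)
      simp only [hu, h0, zero_add] at hx
      linarith
    have hgood : ∀ t, ε * B < t → t ∉ u '' Z →
        volume {x | t < u x} ^ r ≤ c * fracSeminorm δ G ({x | t < u x}.indicator 1) := by
      intro t ht htZ
      have hcl : closure {x | t < u x} ⊆ tsupport f :=
        closure_minimal (fun x hx => hmem t ht x (le_of_lt hx)) (isClosed_tsupport f)
      refine h _ (isOpen_lt continuous_const hud.continuous)
        (IsCompact.of_isClosed_subset hfc isClosed_closure hcl) (hcl.trans hfG)
        (isSmoothHypersurfaceIn_frontier_superlevel hn hud (fun x hx h0 => htZ ⟨x, ?_, hx⟩)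
          (hcl.trans hfG))
      rw [hloc x (hmem t ht x hx.ge)] at h0
      exact h0
    -- A countable critical set has a countable, hence null, set of critical values.
    have hnull : volume (u '' Z) = 0 := (hZ.image u).measure_zero volume
    calc ENNReal.ofReal (s - 2 * (ε * B)) * volume {x | s ≤ f x} ^ r
        = ∫⁻ _ in Ioo (ε * B) (s - ε * B), volume {x | s ≤ f x} ^ r := by
          rw [lintegral_const, Measure.restrict_apply_univ, Real.volume_Ioo, mul_comm]
          congr 2; ring
      _ ≤ ∫⁻ t in Ioo (ε * B) (s - ε * B),
            c * fracSeminorm δ G ({x | t < u x}.indicator 1) := by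
          refine lintegral_mono_ae ?_
          filter_upwards [ae_restrict_mem measurableSet_Ioo,
            ae_restrict_of_ae (compl_mem_ae_iff.2 hnull)] with t ht htZ
          refine (ENNReal.rpow_le_rpow (measure_mono fun x hx => ?_) hr).trans (hgood t ht.1 htZ)
          have h1 : s ≤ f x := hx
          have h2 := (abs_le.1 (hvle x)).1
          show t < f x + v x
          linarith [ht.2]
      _ ≤ ∫⁻ t, c * fracSeminorm δ G ({x | t < u x}.indicator 1) := setLIntegral_le_lintegral _ _
      _ = c * fracSeminorm δ G u := by
          rw [lintegral_const_mul' _ _ hc,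
            ← fracSeminorm_eq_lintegral_superlevel δ G hud.continuous.measurable]
      _ ≤ c * (fracSeminorm δ G f + ENNReal.ofReal ε * M) := by
          refine mul_le_mul_right ((fracSeminorm_add_le δ G hf.continuous.measurable).trans
            (add_le_add le_rfl ((hMle a).trans (mul_le_mul_left ?_ _)))) c
          rw [← ofReal_norm]
          exact ENNReal.ofReal_le_ofReal haε.le
  have hl : Tendsto (fun ε : ℝ => ENNReal.ofReal (s - 2 * (ε * B)) * volume {x | s ≤ f x} ^ r)
      (𝓝[>] 0) (𝓝 (ENNReal.ofReal s * volume {x | s ≤ f x} ^ r)) := by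
    refine ENNReal.Tendsto.mul_const ?_ (Or.inl (by simpa using hs))
    have : Continuous fun ε : ℝ => ENNReal.ofReal (s - 2 * (ε * B)) :=
      ENNReal.continuous_ofReal.comp (by fun_prop)
    simpa using (this.tendsto 0).mono_left nhdsWithin_le_nhds
  have hrr : Tendsto (fun ε : ℝ => c * (fracSeminorm δ G f + ENNReal.ofReal ε * M))
      (𝓝[>] 0) (𝓝 (c * fracSeminorm δ G f)) := by
    refine ENNReal.Tendsto.const_mul ?_ (Or.inr hc)
    have h1 : Tendsto (fun ε : ℝ => ENNReal.ofReal ε * M) (𝓝[>] 0) (𝓝 (ENNReal.ofReal 0 * M)) :=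
      ENNReal.Tendsto.mul_const
        ((ENNReal.continuous_ofReal.tendsto 0).mono_left nhdsWithin_le_nhds) (Or.inr hM)
    simpa using h1.const_add (fracSeminorm δ G f)
  refine le_of_tendsto_of_tendsto hl hrr ?_
  filter_upwards [self_mem_nhdsWithin] with ε hε'
  exact hε ε hε'

/-! ### (B) implies the weak-type bound, and the equivalence. -/

theorem fracSeminorm_const_mul {n : ℕ} (δ : ℝ) (G : Set (EuclideanSpace ℝ (Fin n))) (a : ℝ)
    (u : EuclideanSpace ℝ (Fin n) → ℝ) :
    fracSeminorm δ G (fun x => a * u x) = ‖a‖ₑ * fracSeminorm δ G u := by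
  unfold fracSeminorm
  rw [← lintegral_const_mul' _ _ enorm_ne_top]
  refine lintegral_congr fun x => ?_
  rw [← lintegral_const_mul' _ _ enorm_ne_top]
  refine lintegral_congr fun y => ?_
  rw [← mul_sub, enorm_mul, mul_div_assoc]

/-- The function f/s is admissible for the capacity of the compact set {f ≥ s}, and the seminorm is
homogeneous. -/
theorem measure_superlevel_rpow_le_of_isocapacitary {n : ℕ} {δ r : ℝ} {c : ℝ≥0∞}
    {G : Set (EuclideanSpace ℝ (Fin n))}
    (h : ∀ K : Set (EuclideanSpace ℝ (Fin n)), IsCompact K → K ⊆ G →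
      volume K ^ r ≤ c * fracCapacity δ K G)
    {f : EuclideanSpace ℝ (Fin n) → ℝ} (hf : Continuous f) (hfc : HasCompactSupport f)
    (hfG : tsupport f ⊆ G) {s : ℝ} (hs : 0 < s) :
    ENNReal.ofReal s * volume {x | s ≤ f x} ^ r ≤ c * fracSeminorm δ G f := by
  have hsub : {x | s ≤ f x} ⊆ tsupport f := fun x hx => subset_tsupport f fun h0 =>
    absurd (show s ≤ f x from hx) (not_le.2 (h0 ▸ hs))
  have hK : IsCompact {x | s ≤ f x} :=
    IsCompact.of_isClosed_subset hfc (isClosed_le continuous_const hf) hsub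
  have hts : tsupport (fun x => s⁻¹ * f x) ⊆ tsupport f :=
    tsupport_mul_subset_right (f := fun _ => s⁻¹)
  have hcap : fracCapacity δ {x | s ≤ f x} G ≤ fracSeminorm δ G fun x => s⁻¹ * f x := by
    refine sInf_le ⟨_, continuous_const.mul hf, hfc.mul_left (f := fun _ => s⁻¹),
      hts.trans hfG, fun x hx => ?_, rfl⟩
    have hx' : s ≤ f x := hx
    change 1 ≤ s⁻¹ * f x
    rw [inv_mul_eq_div, one_le_div hs]
    exact hx'
  rw [fracSeminorm_const_mul, enorm_inv hs.ne', Real.enorm_of_nonneg hs.le] at hcap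
  have hs0 : ENNReal.ofReal s ≠ 0 := by simpa using hs
  calc ENNReal.ofReal s * volume {x | s ≤ f x} ^ r
      ≤ ENNReal.ofReal s * (c * ((ENNReal.ofReal s)⁻¹ * fracSeminorm δ G f)) :=
        mul_le_mul_right ((h _ hK (hsub.trans hfG)).trans (mul_le_mul_right hcap c)) _
    _ = (ENNReal.ofReal s * (ENNReal.ofReal s)⁻¹) * (c * fracSeminorm δ G f) := by ring
    _ = c * fracSeminorm δ G f := by
        rw [ENNReal.mul_inv_cancel hs0 ENNReal.ofReal_ne_top, one_mul]

theorem theorem1p1 (n : ℕ) (hn : 2 ≤ n) (G : Set (EuclideanSpace ℝ (Fin n))) (hG : IsOpen G)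
    (δ : ℝ) (hδ0 : 0 < δ) (hδ1 : δ < 1) (C : ℝ) (hC : 0 < C) :
    List.TFAE [
      -- (A) the fractional Sobolev inequality
      ∀ u : EuclideanSpace ℝ (Fin n) → ℝ, AEMeasurable u volume →
        HasCompactSupport u → tsupport u ⊆ G →
        (∫⁻ x in G, ‖u x‖ₑ ^ ((n : ℝ) / (n - δ))) ^ (((n : ℝ) - δ) / n) ≤
          ENNReal.ofReal C * fracSeminorm δ G u,
      -- (B) the fractional isocapacitary inequality
      ∀ K : Set (EuclideanSpace ℝ (Fin n)), IsCompact K → K ⊆ G →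
        volume K ^ (((n : ℝ) - δ) / n) ≤ ENNReal.ofReal C * fracCapacity δ K G,
      -- (C) the fractional isoperimetric inequality
      ∀ D : Set (EuclideanSpace ℝ (Fin n)), IsOpen D → IsCompact (closure D) → closure D ⊆ G →
        IsSmoothHypersurfaceIn (frontier D) G →
        volume D ^ (((n : ℝ) - δ) / n) ≤ ENNReal.ofReal (2 * C) * fracPerimeter δ D G] := by
  have hn1 : 1 ≤ n := by omega
  have hnR : (2 : ℝ) ≤ n := by exact_mod_cast hn
  have hnδ : 0 < (n : ℝ) - δ := by linarith
  set q : ℝ := (n : ℝ) / (n - δ) with hq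
  have hr : ((n : ℝ) - δ) / n = 1 / q := by rw [hq, one_div_div]
  have hq1 : 1 < q := by rw [hq, one_lt_div hnδ]; linarith
  have hq0 : 0 < q := by linarith
  rw [hr]
  set c := ENNReal.ofReal C with hcdef
  have hc : c ≠ ⊤ := ENNReal.ofReal_ne_top
  have hc0 : c ≠ 0 := by simpa [hcdef] using hC
  -- The common final stage of (B) ⇒ (A) and (C) ⇒ (A).
  have hfinish : (∀ f : EuclideanSpace ℝ (Fin n) → ℝ, ContDiff ℝ ∞ f → HasCompactSupport f →
      tsupport f ⊆ G → (∀ x, 0 ≤ f x) → ∀ s : ℝ, 0 < s →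
      ENNReal.ofReal s * volume {x | s ≤ f x} ^ (1 / q) ≤ c * fracSeminorm δ G f) →
      ∀ u : EuclideanSpace ℝ (Fin n) → ℝ, AEMeasurable u volume →
        HasCompactSupport u → tsupport u ⊆ G →
        (∫⁻ x in G, ‖u x‖ₑ ^ q) ^ (1 / q) ≤ c * fracSeminorm δ G u :=
    fun h u hu huc huG => lintegral_rpow_le_fracSeminorm_of_indicator hq1 hc
      (fun E K hE hK hEK hKG => measure_rpow_le_fracSeminorm_indicator hn1 hδ0 hδ1
        (by positivity) hc hG h hE hK hEK hKG) hu huc huG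
  have hper : ∀ D : Set (EuclideanSpace ℝ (Fin n)), IsOpen D → closure D ⊆ G →
      ENNReal.ofReal (2 * C) * fracPerimeter δ D G = c * fracSeminorm δ G (D.indicator 1) := by
    intro D hD hDG
    rw [fracSeminorm_indicator δ hD.measurableSet (subset_closure.trans hDG) hG.measurableSet,
      ENNReal.ofReal_mul zero_le_two, ENNReal.ofReal_ofNat]
    ring
  have hind : ∀ D : Set (EuclideanSpace ℝ (Fin n)), MeasurableSet D → D ⊆ G →
      ∀ u : EuclideanSpace ℝ (Fin n) → ℝ, (∀ x ∈ D, 1 ≤ u x) →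
      volume D ≤ ∫⁻ x in G, ‖u x‖ₑ ^ q := by
    intro D hD hDG u hu
    calc volume D = ∫⁻ _ in D, 1 := by simp
      _ ≤ ∫⁻ x in D, ‖u x‖ₑ ^ q := by
        refine setLIntegral_mono' hD fun x hx => ENNReal.one_le_rpow ?_ hq0
        rw [Real.enorm_eq_ofReal_abs, ENNReal.one_le_ofReal]
        exact (hu x hx).trans (le_abs_self _)
      _ ≤ _ := lintegral_mono_set hDG
  tfae_have 1 → 2 := by
    intro h K hK hKG
    -- Since the constant is neither 0 nor ∞, it can be moved across, and it suffices to bound each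
    -- competitor in the infimum.
    rw [← ENNReal.div_le_iff' hc0 hc]
    refine le_sInf ?_
    rintro _ ⟨u, hu, huc, huG, hu1, rfl⟩
    rw [ENNReal.div_le_iff' hc0 hc]
    exact (ENNReal.rpow_le_rpow (hind K hK.measurableSet hKG u hu1) (by positivity)).trans
      (h u hu.measurable.aemeasurable huc huG)
  tfae_have 2 → 1 := fun h => hfinish fun f hf hfc hfG _ s hs =>
    measure_superlevel_rpow_le_of_isocapacitary h hf.continuous hfc hfG hs
  tfae_have 1 → 3 := by
    intro h D hD hDc hDG _
    rw [hper D hD hDG]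
    have hts : tsupport (D.indicator (1 : EuclideanSpace ℝ (Fin n) → ℝ)) ⊆ closure D :=
      closure_mono support_indicator_subset
    refine (ENNReal.rpow_le_rpow (hind D hD.measurableSet (subset_closure.trans hDG)
      (D.indicator 1) fun x hx => by simp [hx]) (by positivity)).trans
      (h _ (measurable_one.indicator hD.measurableSet).aemeasurable
        (hDc.of_isClosed_subset (isClosed_tsupport _) hts) (hts.trans hDG))
  tfae_have 3 → 1 := fun h => hfinish fun f hf hfc hfG _ s hs =>
    measure_superlevel_rpow_le_of_isoperimetric hn1 hδ0 hδ1 (by positivity) hc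
      (fun D hD hDc hDG hS => (hper D hD hDG) ▸ h D hD hDc hDG hS) hf hfc hfG hs
  tfae_finish
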